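/- Let $\mathbb O$ be the octonions and $\mathbb S=\mathbb O\times\mathbb O$ the sedenions (Cayley--Dickson product $(a,b)(c,d)=(ac-d^*b,\,da+bc^*)$), with canonical bases $e_0,\dots,e_7$ and $e_0,\dots,e_{15}$ and the Euclidean inner product, and let $G_2=\operatorname{Aut}(\mathbb O)$ act diagonally on $\mathbb S$. Let $$V_2(\mathbb R^7)=\{(a,b)\in\mathbb S: a,b\in\operatorname{Im}\mathbb O=\mathbb R^7,\ \|a\|=\|b\|=1,\ a\perp b\},\qquad u_0=(e_1,e_2)=e_1+e_{10}.$$ For $0\le i<j\le 7$ let $E_{ij}\in\mathfrak{so}(8)$ be the matrix with entry $-1$ at $(i,j)$, $+1$ at $(j,i)$ and $0$ elsewhere, and set $$\begin{aligned} X_3&=-\tfrac{\sqrt3}{6}(2E_{23}-E_{45}+E_{67}),& X_4&=\tfrac{\sqrt3}{6}(2E_{13}+E_{46}+E_{57}),& X_5&=-\tfrac{\sqrt3}{6}(2E_{12}-E_{47}+E_{56}),\\ X_6&=-\tfrac12(E_{17}-E_{24}),& X_7&=\tfrac12(E_{16}+E_{25}),& X_8&=-\tfrac12(E_{15}-E_{26}),\\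 X_9&=\tfrac12(E_{14}+E_{27}),& X_{10}&=\tfrac{\sqrt3}{6}(E_{16}-E_{25}+2E_{34}),& X_{11}&=\tfrac{\sqrt3}{6}(E_{17}+E_{24}+2E_{35}),\\ X_{12}&=-\tfrac{\sqrt3}{6}(E_{14}-E_{27}-2E_{36}),& X_{13}&=-\tfrac{\sqrt3}{6}(E_{15}+E_{26}-2E_{37}). \end{aligned}$$ These are elements of $\mathfrak g_2\subset\mathfrak{so}(8)$; let $\mathfrak m$ be their span and $X^3,\dots,X^{13}$ the dual basis of $\mathfrak m^*$. (0) $V_2(\mathbb R^7)$ equals the set $ZD(\mathbb S)=\{u\in\mathbb S:\|u\|=\sqrt2,\ uv=0\text{ for some }v\in\mathbb S\text{ with }\|v\|=\sqrt2\}$ of normalized zero divisors; it is the orbit $G_2\cdot u_0$; and $X\mapsto X\cdot u_0$ is a linear isomorphism $\mathfrak m\simeq T_{u_0}V_2(\mathbb R^7)$. Moreover, for every $r>0$ there is exactly one $G_2$-invariant Riemannian metric $g_r$ on $V_2(\mathbb R^7)$ that is given at $u_0$, under $\mathfrak m\simeq T_{u_0}V_2(\mathbb R^7)$, by $$g_r=\tfrac13(X^3\otimes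 X^3+X^4\otimes X^4)+r\,X^5\otimes X^5+\tfrac12\sum_{i=6}^{9}X^i\otimes X^i+\tfrac16\sum_{i=10}^{13}X^i\otimes X^i ,$$ and $g_{2/3}$ is the metric induced on $ZD(\mathbb S)$ by the Euclidean metric of $\mathbb S$. Let $Y_i=X_i/\sqrt{g_r(X_i,X_i)}$ ($3\le i\le 13$) be the $g_r$-orthonormal basis of $\mathfrak m$ obtained by normalization, with dual basis $Y^i$. Then, for every $r>0$: (1) the Ricci tensor of $g_r$ is the $G_2$-invariant tensor given at $u_0$ by $$\operatorname{Ric}_{g_r}=\tfrac{15r}{2}\,Y^5\otimes Y^5+\Bigl(5-\tfrac{3r}{2}\Bigr)\sum_{i\ne5}Y^i\otimes Y^i ;$$ (2) $g_r$ is Einstein if and only if $r=\tfrac59$; (3) the scalar curvature of $g_r$ is the constant $50-\tfrac{15}{2}r$; it is positive if and only if $r<\tfrac{20}{3}$. -/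

import Mathlib

open scoped ContDiff

noncomputable section

/-! ### The Cayley-Dickson construction -/

/-- The Cayley-Dickson double of `A`: the space `A × A` with its Euclidean (`L²`) norm. -/
def CD (A : Type) : Type := WithLp 2 (A × A)

namespace CD

variable {A : Type}

/-- The pair `(a, b)`. -/
def mk (a b : A) : CD A := WithLp.toLp 2 (a, b)

/-- First component. -/
def fst (x : CD A) : A := (WithLp.ofLp x).1

/-- Second component. -/
def snd (x : CD A) : A := (WithLp.ofLp x).2

variable [NormedAddCommGroup A]

instance instNormedAddCommGroup : NormedAddCommGroup (CD A) :=
  inferInstanceAs (NormedAddCommGroup (WithLp 2 (A × A)))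

instance instInnerProductSpace [InnerProductSpace ℝ A] : InnerProductSpace ℝ (CD A) :=
  inferInstanceAs (InnerProductSpace ℝ (WithLp 2 (A × A)))

/-- `(a, b) (c, d) = (a c - d* b, d a + b c*)`. -/
instance instMul [Mul A] [Star A] : Mul (CD A) :=
  ⟨fun x y => mk (x.fst * y.fst - star y.snd * x.snd) (y.snd * x.fst + x.snd * star y.fst)⟩

/-- `(a, b)* = (a*, -b)`. -/
instance instStar [Star A] : Star (CD A) := ⟨fun x => mk (star x.fst) (-x.snd)⟩

/-- A linear map acting diagonally on pairs. -/
def diag [InnerProductSpace ℝ A] (T : A →ₗ[ℝ] A) : CD A →ₗ[ℝ] CD A where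
  toFun x := mk (T x.fst) (T x.snd)
  map_add' x y := congrArg (WithLp.toLp 2) (Prod.ext (map_add T x.fst y.fst) (map_add T x.snd y.snd))
  map_smul' c x := congrArg (WithLp.toLp 2) (Prod.ext (map_smul T c x.fst) (map_smul T c x.snd))

end CD

/-- The octonions, the third Cayley-Dickson double of `ℝ`. -/
abbrev Oct : Type := CD (CD (CD ℝ))

/-- The sedenions, the Cayley-Dickson double of the octonions; as a Euclidean space this is
`ℝ¹⁶`. -/
abbrev Sed : Type := CD Oct

/-- The canonical basis `e₀, …, e₇` of the octonions. -/
def octBasis : Fin 8 → Oct :=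
  ![.mk (.mk (.mk 1 0) 0) 0, .mk (.mk (.mk 0 1) 0) 0,
    .mk (.mk 0 (.mk 1 0)) 0, .mk (.mk 0 (.mk 0 1)) 0,
    .mk 0 (.mk (.mk 1 0) 0), .mk 0 (.mk (.mk 0 1) 0),
    .mk 0 (.mk 0 (.mk 1 0)), .mk 0 (.mk 0 (.mk 0 1))]

/-- Imaginary octonions; they form `Im 𝕆 = ℝ⁷`. -/
def IsImag (x : Oct) : Prop := star x = -x

/-- The normalized zero divisors of the sedenions. -/
def sedZeroDivisors : Set Sed :=
  {u | ∃ v : Sed, ‖u‖ = √2 ∧ ‖v‖ = √2 ∧ u * v = 0}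

/-- The Stiefel manifold `V₂(ℝ⁷)` of orthonormal pairs in `ℝ⁷ = Im 𝕆`, as a subset of
`𝕊 = 𝕆 × 𝕆`. -/
def stiefel : Set Sed :=
  {u | IsImag u.fst ∧ IsImag u.snd ∧ ‖u.fst‖ = 1 ∧ ‖u.snd‖ = 1 ∧ inner ℝ u.fst u.snd = 0}

/-- The base point `(e₁, e₂) = e₁ + e₁₀` of `V₂(ℝ⁷)`. -/
def stiefelBase : Sed := .mk (octBasis 1) (octBasis 2)

/-- The group `G₂ = Aut(𝕆)`. -/
def G2 : Subgroup (Oct ≃ₗ[ℝ] Oct) where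
  carrier := {h | ∀ x y : Oct, h (x * y) = h x * h y}
  mul_mem' {h k} hh hk x y := by
    change h (k (x * y)) = h (k x) * h (k y)
    rw [hk, hh]
  one_mem' _ _ := rfl
  inv_mem' {h} hh x y := by
    change h.symm (x * y) = h.symm x * h.symm y
    apply h.injective
    rw [hh, h.apply_symm_apply, h.apply_symm_apply, h.apply_symm_apply]

/-- The diagonal action of an octonion automorphism on `𝕊 = 𝕆 × 𝕆`. -/
abbrev g2Act (h : G2) : Sed →ₗ[ℝ] Sed := CD.diag ((h : Oct ≃ₗ[ℝ] Oct) : Oct →ₗ[ℝ] Oct)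

/-- The skew map `E_{ij}`, with `e_i ↦ e_j` and `e_j ↦ -e_i`: its matrix has entry `-1` in row `i`,
column `j` and `+1` in row `j`, column `i`. -/
def skewE (i j : Fin 8) : Oct →ₗ[ℝ] Oct :=
  (innerₗ Oct (octBasis i)).smulRight (octBasis j) - (innerₗ Oct (octBasis j)).smulRight (octBasis i)

/-- The basis `X₀, …, X₁₃` of the Lie algebra `𝔤₂ ⊂ 𝔰𝔬(8)`. The first three elements span the
isotropy algebra at the base point, and the remaining eleven span the complement `𝔪`. -/
def g2Basis : Fin 14 → (Oct →ₗ[ℝ] Oct) :=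
  ![(1 / 2 : ℝ) • (skewE 4 5 + skewE 6 7),
    (1 / 2 : ℝ) • (skewE 4 6 - skewE 5 7),
    (1 / 2 : ℝ) • (skewE 4 7 + skewE 5 6),
    -(√3 / 6 : ℝ) • ((2 : ℝ) • skewE 2 3 - skewE 4 5 + skewE 6 7),
    (√3 / 6 : ℝ) • ((2 : ℝ) • skewE 1 3 + skewE 4 6 + skewE 5 7),
    -(√3 / 6 : ℝ) • ((2 : ℝ) • skewE 1 2 - skewE 4 7 + skewE 5 6),
    -(1 / 2 : ℝ) • (skewE 1 7 - skewE 2 4),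
    (1 / 2 : ℝ) • (skewE 1 6 + skewE 2 5),
    -(1 / 2 : ℝ) • (skewE 1 5 - skewE 2 6),
    (1 / 2 : ℝ) • (skewE 1 4 + skewE 2 7),
    (√3 / 6 : ℝ) • (skewE 1 6 - skewE 2 5 + (2 : ℝ) • skewE 3 4),
    (√3 / 6 : ℝ) • (skewE 1 7 + skewE 2 4 + (2 : ℝ) • skewE 3 5),
    -(√3 / 6 : ℝ) • (skewE 1 4 - skewE 2 7 - (2 : ℝ) • skewE 3 6),
    -(√3 / 6 : ℝ) • (skewE 1 5 + skewE 2 6 - (2 : ℝ) • skewE 3 7)]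

/-- The value at the base point of the fundamental vector field of `X_i`, that is, the derivative
at `t = 0` of `exp(t X_i) · (e₁, e₂)`. -/
def baseVec (i : Fin 14) : Sed := CD.diag (g2Basis i) stiefelBase

/-! ### Riemannian geometry of a submanifold

`E` is a finite-dimensional Euclidean space and `M ⊂ E` a closed embedded submanifold. Smooth
functions, vector fields and metrics on `M` are the restrictions to `M` of smooth ones on `E`
(every smooth object on `M` extends); all conditions are imposed only on `M` and on tangent
vectors of `M`. -/

section Riemannian

variable {E : Type} [NormedAddCommGroup E] [InnerProductSpace ℝ E]

/-- The tangent space of `M` at `p`: velocities at `p` of smooth curves in `M`. (For a submanifold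
the velocities already form a linear subspace.) -/
def tangentSpaceOf (M : Set E) (p : E) : Submodule ℝ E :=
  Submodule.span ℝ {v | ∃ γ : ℝ → E, ContDiff ℝ ∞ γ ∧ (∀ t, γ t ∈ M) ∧ γ 0 = p ∧ deriv γ 0 = v}

/-- Smooth vector fields on `M`. -/
def IsVectorField (M : Set E) (X : E → E) : Prop :=
  ContDiff ℝ ∞ X ∧ ∀ p ∈ M, X p ∈ tangentSpaceOf M p

/-- Smooth Riemannian metrics on `M`. -/
structure IsRiemannianMetric (M : Set E) (g : E → E →L[ℝ] E →L[ℝ] ℝ) : Prop where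
  smooth : ContDiff ℝ ∞ g
  symm : ∀ p ∈ M, ∀ x ∈ tangentSpaceOf M p, ∀ y ∈ tangentSpaceOf M p, g p x y = g p y x
  pos : ∀ p ∈ M, ∀ x ∈ tangentSpaceOf M p, x ≠ 0 → 0 < g p x x

/-- `D X Y = ∇_X Y` is the Levi-Civita connection of `(M, g)`: a connection on the tangent bundle of
`M` that is torsion-free and compatible with the metric. Here `VectorField.lieBracket ℝ X Y` is
`[X, Y]`. -/
structure IsLeviCivita (M : Set E) (g : E → E →L[ℝ] E →L[ℝ] ℝ) (D : (E → E) → (E → E) → E → E) :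
    Prop where
  isVectorField : ∀ X Y, IsVectorField M X → IsVectorField M Y → IsVectorField M (D X Y)
  add_left : ∀ X X' Y, IsVectorField M X → IsVectorField M X' → IsVectorField M Y →
    ∀ p ∈ M, D (X + X') Y p = D X Y p + D X' Y p
  smul_left : ∀ (f : E → ℝ) (X Y : E → E), ContDiff ℝ ∞ f → IsVectorField M X → IsVectorField M Y →
    ∀ p ∈ M, D (fun q => f q • X q) Y p = f p • D X Y p
  add_right : ∀ X Y Y', IsVectorField M X → IsVectorField M Y → IsVectorField M Y' →
    ∀ p ∈ M, D X (Y + Y') p = D X Y p + D X Y' p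
  leibniz : ∀ (f : E → ℝ) (X Y : E → E), ContDiff ℝ ∞ f → IsVectorField M X → IsVectorField M Y →
    ∀ p ∈ M, D X (fun q => f q • Y q) p = fderiv ℝ f p (X p) • Y p + f p • D X Y p
  torsion_free : ∀ X Y, IsVectorField M X → IsVectorField M Y →
    ∀ p ∈ M, D X Y p - D Y X p = VectorField.lieBracket ℝ X Y p
  metric : ∀ X Y Z, IsVectorField M X → IsVectorField M Y → IsVectorField M Z →
    ∀ p ∈ M, fderiv ℝ (fun q => g q (Y q) (Z q)) p (X p) = g p (D X Y p) (Z p) + g p (Y p) (D X Z p)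

open Classical in
/-- The Levi-Civita connection of `(M, g)` (its values along `M` are unique). -/
def leviCivita (M : Set E) (g : E → E →L[ℝ] E →L[ℝ] ℝ) : (E → E) → (E → E) → E → E :=
  if h : ∃ D, IsLeviCivita M g D then h.choose else 0

/-- `R(X, Y) Z = ∇_X ∇_Y Z - ∇_Y ∇_X Z - ∇_{[X, Y]} Z`. -/
def curvature (M : Set E) (g : E → E →L[ℝ] E →L[ℝ] ℝ) (X Y Z : E → E) : E → E :=
  leviCivita M g X (leviCivita M g Y Z) - leviCivita M g Y (leviCivita M g X Z)
    - leviCivita M g (VectorField.lieBracket ℝ X Y) Z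

/-- `A` is the endomorphism `z ↦ R(z, x) y` of the tangent space at `p`. -/
def IsCurvatureEndo (M : Set E) (g : E → E →L[ℝ] E →L[ℝ] ℝ) (p x y : E)
    (A : tangentSpaceOf M p →ₗ[ℝ] tangentSpaceOf M p) : Prop :=
  ∀ X Y Z, IsVectorField M X → IsVectorField M Y → IsVectorField M Z → X p = x → Y p = y →
    ∀ z : tangentSpaceOf M p, (z : E) = Z p → (A z : E) = curvature M g Z X Y p

open Classical in
/-- The endomorphism `z ↦ R(z, x) y` of the tangent space at `p`. -/
def curvatureEndo (M : Set E) (g : E → E →L[ℝ] E →L[ℝ] ℝ) (p x y : E) :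
    tangentSpaceOf M p →ₗ[ℝ] tangentSpaceOf M p :=
  if h : ∃ A, IsCurvatureEndo M g p x y A then h.choose else 0

/-- The Ricci tensor: `Ric_p(x, y)` is the trace of `z ↦ R(z, x) y`. -/
def ricci (M : Set E) (g : E → E →L[ℝ] E →L[ℝ] ℝ) (p x y : E) : ℝ :=
  LinearMap.trace ℝ _ (curvatureEndo M g p x y)

/-- `S` is the Ricci endomorphism at `p`: `g(S x, y) = Ric(x, y)`. -/
def IsRicciEndo (M : Set E) (g : E → E →L[ℝ] E →L[ℝ] ℝ) (p : E)
    (S : tangentSpaceOf M p →ₗ[ℝ] tangentSpaceOf M p) : Prop :=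
  ∀ x y : tangentSpaceOf M p, g p (S x) y = ricci M g p x y

open Classical in
/-- The scalar curvature at `p`: the trace of the Ricci endomorphism. -/
def scalarCurvature (M : Set E) (g : E → E →L[ℝ] E →L[ℝ] ℝ) (p : E) : ℝ :=
  if h : ∃ S, IsRicciEndo M g p S then LinearMap.trace ℝ _ h.choose else 0

/-- `(M, g)` is Einstein: `Ric = λ g` for a constant `λ`. -/
def IsEinstein (M : Set E) (g : E → E →L[ℝ] E →L[ℝ] ℝ) : Prop :=
  ∃ c : ℝ, ∀ p ∈ M, ∀ x ∈ tangentSpaceOf M p, ∀ y ∈ tangentSpaceOf M p,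
    ricci M g p x y = c * g p x y

end Riemannian

/-! ### The metrics `g_r` -/

/-- The coefficients of `g_r` in the dual basis `X³, …, X¹³` (the first three entries belong to
the isotropy algebra). -/
def grCoeff (r : ℝ) : Fin 14 → ℝ :=
  ![0, 0, 0, 1 / 3, 1 / 3, r, 1 / 2, 1 / 2, 1 / 2, 1 / 2, 1 / 6, 1 / 6, 1 / 6, 1 / 6]

/-- `g` is the metric `g_r` on `V₂(ℝ⁷)`: it is `G₂`-invariant, and at the base point, under
`𝔪 ≃ T V₂(ℝ⁷)`, `X ↦ X · (e₁, e₂)`, it is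
`⅓ (X³⊗X³ + X⁴⊗X⁴) + r X⁵⊗X⁵ + ½ ∑_{6 ≤ i ≤ 9} Xⁱ⊗Xⁱ + ⅙ ∑_{10 ≤ i ≤ 13} Xⁱ⊗Xⁱ`. -/
structure IsMetricGr (r : ℝ) (g : Sed → Sed →L[ℝ] Sed →L[ℝ] ℝ) : Prop where
  isRiemannianMetric : IsRiemannianMetric stiefel g
  invariant : ∀ h : G2, ∀ p ∈ stiefel, ∀ x ∈ tangentSpaceOf stiefel p,
    ∀ y ∈ tangentSpaceOf stiefel p, g (g2Act h p) (g2Act h x) (g2Act h y) = g p x y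
  base : ∀ i j : Fin 14, 3 ≤ i → 3 ≤ j →
    g stiefelBase (baseVec i) (baseVec j) = if i = j then grCoeff r i else 0

/-- The tangent vector at the base point given by the `g_r`-unit vector `Y_i = X_i / |X_i|`. -/
def unitVec (r : ℝ) (i : Fin 14) : Sed := (√(grCoeff r i))⁻¹ • baseVec i

end

/-!
The key observation is that `g_r` has a closed form that does not mention `G₂`. Let
`rot (a, b) = (-b, a)` be the infinitesimal rotation of a pair, and `η_p(x) = ⟪rot p, x⟫`. The fifth
basis vector `X₅` acts at the base point as `rot / √3`, and the other `X_i` give vectors orthogonal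
to it whose Euclidean inner products are the coefficients of `g_r` (`inner_baseVec`), so that
`g_r = ⟪·,·⟫ + c η ⊗ η` with `c = 3 r / 4 - 1 / 2` (`IsMetricGr.isSquashed`). The geometry can
therefore be computed for orthonormal pairs in a hyperplane `e^⊥` of an arbitrary eight-dimensional
Euclidean space, with the help of the orthogonal group only (`CD.orthoPairs`, `CD.squashedMetric`).

The submanifold is cut out by quadratic equations, so its second fundamental form is a polynomial
in the position (`CD.normalForm`). Since `rot` is a Killing field, the term `c η ⊗ η` changes the
connection by `c (η(y) rot x + η(x) rot y)`, up to a normal correction. Hence the Levi-Civita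
connection is the flat derivative plus a Christoffel form (`CD.christoffel`) that is polynomial in
the position and defined on the whole ambient space (`CD.isLeviCivita_connection`). It is unique
along the submanifold (`IsLeviCivita.eq`), and the usual formula with first derivatives and squares
of the Christoffel form gives the curvature tensor (`CD.curvature_eq`).

At `p = (a, b)`, complete `e, a, b` to an orthonormal basis by `w₁, …, w₅`. The vectors `rot p / √2`,
`(w_k, 0)`, `(0, w_k)` form an orthonormal basis of the tangent space (`CD.trace_eq`). Summing the
curvature over it with Parseval's identity yields
`Ric = (4 - 2 c) g + (12 c² + 7 c + 1/2) η ⊗ η` (`CD.ricci_eq`), from which the Einstein condition and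
the scalar curvature follow.

On the algebraic side, the octonions satisfy `x* (x y) = |x|² y`. An isometric `*`-embedding
`φ` of an algebra `A` in `𝕆` extends to the double of `A` by `(x, y) ↦ φ x + (φ y) c` for any unit
vector `c` orthogonal to the image (`Oct.IsEmbedding.extend`). Three doublings starting from `ℝ`
extend each orthonormal pair of imaginary octonions to an automorphism, so `G₂` acts transitively on
such pairs; conversely an automorphism is an isometry, because imaginary octonions are
characterized by their squares (`G2.map_imag`). For a product of sedenions to vanish, all four
components have to be units and `x (d y) + (x d) y = 0` with `x` conjugate to the first component `a`,
`y` the second component `b`, and a unit `d`; pairing this equation with suitable vectors shows that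
`a` and `b` are imaginary and orthogonal (`Oct.imag_of_mul_mul_add`).
-/

noncomputable section

/-! ### Components of Cayley-Dickson doubles -/

namespace CD

section Basic

variable {A : Type}

@[ext] theorem ext {x y : CD A} (h₁ : x.fst = y.fst) (h₂ : x.snd = y.snd) : x = y :=
  congrArg (WithLp.toLp 2) (Prod.ext h₁ h₂)

@[simp] theorem fst_mk (a b : A) : (mk a b).fst = a := rfl
@[simp] theorem snd_mk (a b : A) : (mk a b).snd = b := rfl

variable [NormedAddCommGroup A]

@[simp] theorem fst_zero : (0 : CD A).fst = 0 := rfl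
@[simp] theorem snd_zero : (0 : CD A).snd = 0 := rfl
@[simp] theorem fst_add (x y : CD A) : (x + y).fst = x.fst + y.fst := rfl
@[simp] theorem snd_add (x y : CD A) : (x + y).snd = x.snd + y.snd := rfl
@[simp] theorem fst_sub (x y : CD A) : (x - y).fst = x.fst - y.fst := rfl
@[simp] theorem snd_sub (x y : CD A) : (x - y).snd = x.snd - y.snd := rfl
@[simp] theorem fst_neg (x : CD A) : (-x).fst = -x.fst := rfl
@[simp] theorem snd_neg (x : CD A) : (-x).snd = -x.snd := rfl

section Star

variable [Star A]

theorem fst_mul [Mul A] (x y : CD A) : (x * y).fst = x.fst * y.fst - star y.snd * x.snd := rfl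
theorem snd_mul [Mul A] (x y : CD A) : (x * y).snd = y.snd * x.fst + x.snd * star y.fst := rfl
theorem fst_star (x : CD A) : (star x).fst = star x.fst := rfl
theorem snd_star (x : CD A) : (star x).snd = -x.snd := rfl

end Star

variable [InnerProductSpace ℝ A]

@[simp] theorem fst_smul (r : ℝ) (x : CD A) : (r • x).fst = r • x.fst := rfl
@[simp] theorem snd_smul (r : ℝ) (x : CD A) : (r • x).snd = r • x.snd := rfl

theorem inner_def (x y : CD A) :
    inner ℝ x y = inner ℝ x.fst y.fst + inner ℝ x.snd y.snd := rfl

theorem norm_sq_def (x : CD A) : ‖x‖ ^ 2 = ‖x.fst‖ ^ 2 + ‖x.snd‖ ^ 2 := by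
  simp only [← real_inner_self_eq_norm_sq, inner_def]

instance instFiniteDimensional [FiniteDimensional ℝ A] : FiniteDimensional ℝ (CD A) :=
  inferInstanceAs (FiniteDimensional ℝ (WithLp 2 (A × A)))

theorem finrank_eq [FiniteDimensional ℝ A] :
    Module.finrank ℝ (CD A) = 2 * Module.finrank ℝ A := by
  have h : Module.finrank ℝ (CD A) = Module.finrank ℝ (A × A) :=
    (WithLp.linearEquiv 2 ℝ (A × A)).finrank_eq
  rw [h, Module.finrank_prod, two_mul]

end Basic

end CD

theorem finrank_oct : Module.finrank ℝ Oct = 8 := by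
  simp [CD.finrank_eq]

/-! ### The octonions as a composition algebra -/

namespace Oct

/-- The additive group of this ring is the one underlying the norm of `Oct`. -/
instance instNonAssocRing : NonAssocRing Oct :=
  { (inferInstance : AddCommGroup Oct) with
    mul := (· * ·)
    one := octBasis 0
    left_distrib := fun x y z => by
      ext <;> simp [CD.fst_mul, CD.snd_mul, CD.fst_star, CD.snd_star] <;> ring
    right_distrib := fun x y z => by
      ext <;> simp [CD.fst_mul, CD.snd_mul, CD.fst_star, CD.snd_star] <;> ring
    zero_mul := fun x => by
      ext <;> simp [CD.fst_mul, CD.snd_mul, CD.fst_star, CD.snd_star]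
    mul_zero := fun x => by
      ext <;> simp [CD.fst_mul, CD.snd_mul, CD.fst_star, CD.snd_star]
    one_mul := fun x => by
      change octBasis 0 * x = x
      ext <;> simp [CD.fst_mul, CD.snd_mul, CD.fst_star, CD.snd_star, octBasis]
    mul_one := fun x => by
      change x * octBasis 0 = x
      ext <;> simp [CD.fst_mul, CD.snd_mul, CD.fst_star, CD.snd_star, octBasis] }

theorem one_def : (1 : Oct) = octBasis 0 := rfl

instance instIsScalarTower : IsScalarTower ℝ Oct Oct :=
  ⟨fun r x y => by
    ext <;> simp [CD.fst_mul, CD.snd_mul, CD.fst_star, CD.snd_star] <;> ring⟩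

instance instSMulCommClass : SMulCommClass ℝ Oct Oct :=
  ⟨fun r x y => by
    ext <;> simp [CD.fst_mul, CD.snd_mul, CD.fst_star, CD.snd_star] <;> ring⟩

theorem star_star (x : Oct) : star (star x) = x := by
  ext <;> simp [CD.fst_star, CD.snd_star]

theorem star_add (x y : Oct) : star (x + y) = star x + star y := by
  ext <;> simp [CD.fst_star, CD.snd_star] <;> ring

theorem star_mul (x y : Oct) : star (x * y) = star y * star x := by
  ext <;> simp [CD.fst_mul, CD.snd_mul, CD.fst_star, CD.snd_star] <;> ring

theorem inner_mul_left (x y z : Oct) : inner ℝ (x * y) z = inner ℝ y (star x * z) := by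
  simp [CD.inner_def, CD.fst_mul, CD.snd_mul, CD.fst_star, CD.snd_star]; ring

theorem inner_mul_right (x y z : Oct) : inner ℝ (x * y) z = inner ℝ x (z * star y) := by
  simp [CD.inner_def, CD.fst_mul, CD.snd_mul, CD.fst_star, CD.snd_star]; ring

/-- The polarization of `x* (x z) = |x|² z`, the identity that makes the octonions a composition
algebra. -/
theorem star_mul_mul_add (x y z : Oct) :
    star x * (y * z) + star y * (x * z) = (2 * inner ℝ x y) • z := by
  ext <;> simp [CD.inner_def, CD.fst_mul, CD.snd_mul, CD.fst_star, CD.snd_star] <;> ring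

theorem star_eq (x : Oct) : star x = (2 * inner ℝ 1 x) • (1 : Oct) - x := by
  rw [one_def]
  ext <;> simp [CD.inner_def, CD.fst_star, CD.snd_star, octBasis]
  ring

theorem inner_one_one : inner ℝ (1 : Oct) 1 = 1 := by
  rw [one_def]; simp [CD.inner_def, octBasis, -inner_self_eq_norm_sq_to_K]

theorem star_one : star (1 : Oct) = 1 := by
  rw [star_eq, inner_one_one]; module

theorem inner_star_star (x y : Oct) : inner ℝ (star x) (star y) = inner ℝ x y := by
  rw [star_eq x, star_eq y]
  simp only [inner_sub_left, inner_sub_right, inner_smul_left, inner_smul_right, inner_one_one,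
    real_inner_comm x 1, conj_trivial]
  ring

theorem isImag_iff (x : Oct) : IsImag x ↔ inner ℝ 1 x = 0 := by
  rw [IsImag, star_eq]
  constructor
  · intro h
    have h1 : (2 * inner ℝ 1 x) • (1 : Oct) = 0 := by
      rw [sub_eq_iff_eq_add] at h; rw [h]; abel
    have h2 := congrArg (inner ℝ (1 : Oct)) h1
    rw [inner_smul_right, inner_one_one, inner_zero_right] at h2
    linarith
  · intro h
    rw [h]; simp

theorem mul_mul_star_add (x y z : Oct) :
    (z * x) * star y + (z * y) * star x = (2 * inner ℝ x y) • z := by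
  have h := congrArg star (star_mul_mul_add (star x) (star y) (star z))
  have hs : star ((2 * inner ℝ x y) • star z) = (2 * inner ℝ x y) • z := by
    rw [star_eq, star_eq z, inner_smul_right, inner_sub_right, inner_smul_right, inner_one_one]
    module
  rw [inner_star_star, hs, star_add] at h
  rw [add_comm]
  simpa only [star_mul, star_star] using h

theorem star_mul_mul (x y : Oct) : star x * (x * y) = (inner ℝ x x) • y := by
  have h := star_mul_mul_add x x y
  have h2 : (2 : ℝ) • (star x * (x * y)) = (2 : ℝ) • (inner ℝ x x • y) := by
    rw [two_smul, h, mul_smul]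
  exact smul_right_injective Oct (two_ne_zero' ℝ) h2

theorem inner_mul_mul_left (x y z : Oct) :
    inner ℝ (x * y) (x * z) = inner ℝ x x * inner ℝ y z := by
  rw [inner_mul_left, star_mul_mul, inner_smul_right]

theorem inner_mul_mul_right (x y z : Oct) :
    inner ℝ (x * z) (y * z) = inner ℝ z z * inner ℝ x y := by
  rw [← inner_star_star, star_mul, star_mul, inner_mul_mul_left, inner_star_star, inner_star_star]

theorem norm_mul (x y : Oct) : ‖x * y‖ = ‖x‖ * ‖y‖ := by
  rw [← sq_eq_sq₀ (norm_nonneg _) (by positivity), mul_pow, ← real_inner_self_eq_norm_sq,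
    inner_mul_mul_left, real_inner_self_eq_norm_sq, real_inner_self_eq_norm_sq]

theorem norm_star (x : Oct) : ‖star x‖ = ‖x‖ := by
  rw [← sq_eq_sq₀ (norm_nonneg _) (norm_nonneg _), ← real_inner_self_eq_norm_sq,
    inner_star_star, real_inner_self_eq_norm_sq]

theorem star_neg (x : Oct) : star (-x) = -star x := by
  rw [star_eq, star_eq x, inner_neg_right]; module

/-- If `c` is imaginary and orthogonal to `w`, then `w c` is imaginary as well, so that
`w c = -(w c)* = c w*`. -/
theorem mul_eq_mul_star {w c : Oct} (hc : star c = -c) (h : inner ℝ w c = 0) :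
    w * c = c * star w := by
  have h1 : inner ℝ 1 (w * c) = 0 := by
    rw [real_inner_comm, inner_mul_right, one_mul, hc, inner_neg_right, h, neg_zero]
  have h2 : star (w * c) = -(w * c) := (isImag_iff _).2 h1
  rw [star_mul, hc, neg_mul] at h2
  exact (neg_injective h2).symm

/-! ### Cayley-Dickson doubling inside the octonions and transitivity of `G₂` -/

/-- An isometric unital embedding of a `*`-algebra (with possibly non-associative product) in the
octonions. -/
structure IsEmbedding {A : Type} [NormedAddCommGroup A] [InnerProductSpace ℝ A] [Mul A] [Star A]
    (φ : A →ₗ[ℝ] Oct) : Prop where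
  map_mul : ∀ x y, φ (x * y) = φ x * φ y
  map_star : ∀ x, φ (star x) = star (φ x)
  inner_map : ∀ x y, inner ℝ (φ x) (φ y) = inner ℝ x y
  one_mem : ∃ u, φ u = 1

/-- The map `(x, y) ↦ φ x + (φ y) c` on the Cayley-Dickson double. -/
def extend {A : Type} [NormedAddCommGroup A] [InnerProductSpace ℝ A] (φ : A →ₗ[ℝ] Oct) (c : Oct) :
    CD A →ₗ[ℝ] Oct where
  toFun x := φ x.fst + φ x.snd * c
  map_add' x y := by simp only [CD.fst_add, CD.snd_add, map_add, add_mul]; abel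
  map_smul' r x := by
    simp only [CD.fst_smul, CD.snd_smul, map_smul, smul_mul_assoc, smul_add, RingHom.id_apply]

/-- Cayley-Dickson doubling inside the octonions: a unit vector orthogonal to the image of an
embedding extends the embedding to the double. -/
theorem IsEmbedding.extend {A : Type} [NormedAddCommGroup A] [InnerProductSpace ℝ A] [Mul A]
    [Star A] {φ : A →ₗ[ℝ] Oct} (hφ : IsEmbedding φ) {c : Oct} (hc : ‖c‖ = 1)
    (hperp : ∀ x, inner ℝ (φ x) c = 0) : IsEmbedding (extend φ c) := by
  obtain ⟨u, hu⟩ := hφ.one_mem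
  have hcc : inner ℝ c c = 1 := by rw [real_inner_self_eq_norm_sq, hc]; norm_num
  have hci : star c = -c := (isImag_iff c).2 (hu ▸ hperp u)
  have hperp' : ∀ x, inner ℝ c (φ x) = 0 := fun x => by rw [real_inner_comm]; exact hperp x
  have key1 : ∀ x y, φ x * (φ y * c) = (φ y * φ x) * c := by
    intro x y
    have h := star_mul_mul_add (star (φ x)) c (star (φ y))
    rw [star_star, hci, ← hφ.map_star x, hperp, mul_zero, zero_smul, neg_mul, hφ.map_star,
      ← star_mul] at h
    rw [mul_eq_mul_star hci (hperp y), add_neg_eq_zero.1 h,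
      mul_eq_mul_star hci (by rw [← hφ.map_mul]; exact hperp _)]
  have key2 : ∀ x y, (φ x * c) * φ y = (φ x * star (φ y)) * c := by
    intro x y
    have h := mul_mul_star_add c (star (φ y)) (φ x)
    rw [star_star, hci, ← hφ.map_star y, hperp', mul_zero, zero_smul, mul_neg, hφ.map_star] at h
    exact add_neg_eq_zero.1 h
  have hci1 : ∀ x, star (φ x * c) = -(φ x * c) := fun x => by
    rw [isImag_iff _ |>.2]
    rw [real_inner_comm, inner_mul_right, one_mul, hci, inner_neg_right, hperp, neg_zero]
  have key3 : ∀ x y, (φ x * c) * (φ y * c) = -(star (φ y) * φ x) := by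
    intro x y
    have h := star_mul_mul_add (star (φ x * c)) c (star (φ y))
    have h1 : inner ℝ (star (φ x * c)) c = - inner ℝ 1 (φ x) := by
      rw [hci1, inner_neg_left, inner_mul_right, hci, mul_neg, ← neg_mul, ← hci]
      have := star_mul_mul c 1
      rw [mul_one] at this
      rw [this, hcc, one_smul, real_inner_comm]
    have h2 : c * (φ x * c * star (φ y)) = - (star (φ y) * star (φ x)) := by
      rw [← hφ.map_star, key2, hφ.map_star, star_star,
        mul_eq_mul_star hci (by rw [← hφ.map_mul]; exact hperp _)]
      have h3 := star_mul_mul c (star (φ x * φ y))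
      rw [hcc, one_smul, hci, neg_mul] at h3
      rw [← star_mul, ← neg_eq_iff_eq_neg, h3]
    rw [star_star, h1, hci, hci1, neg_mul, neg_mul, mul_neg, neg_neg, h2] at h
    rw [mul_eq_mul_star hci (hperp y)]
    rw [star_eq (φ x), mul_sub, mul_smul_comm, mul_one] at h
    rw [eq_sub_of_add_eq h, eq_comm]
    module
  refine ⟨fun x y => ?_, fun x => ?_, fun x y => ?_, ⟨CD.mk u 0, ?_⟩⟩
  · change φ (x * y).fst + φ (x * y).snd * c = (φ x.fst + φ x.snd * c) * (φ y.fst + φ y.snd * c)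
    rw [CD.fst_mul, CD.snd_mul, map_sub, map_add, hφ.map_mul, hφ.map_mul, hφ.map_mul, hφ.map_mul,
      hφ.map_star, hφ.map_star, mul_add, add_mul, add_mul, add_mul, key1, key2, key3]
    abel
  · change φ (star x).fst + φ (star x).snd * c = star (φ x.fst + φ x.snd * c)
    rw [star_add, hci1, CD.fst_star, CD.snd_star, hφ.map_star, map_neg, neg_mul]
  · change inner ℝ (φ x.fst + φ x.snd * c) (φ y.fst + φ y.snd * c) = _
    have h : ∀ x y, inner ℝ (φ x) (φ y * c) = 0 := fun x y => by
      rw [real_inner_comm, inner_mul_left, ← hφ.map_star, ← hφ.map_mul, hperp']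
    have h' : ∀ x y, inner ℝ (φ y * c) (φ x) = 0 := fun x y => by rw [real_inner_comm, h]
    rw [inner_add_left, inner_add_right, inner_add_right, inner_mul_mul_right, hcc, h, h', hφ.inner_map, hφ.inner_map, CD.inner_def]
    ring
  · change φ u + φ 0 * c = 1
    rw [map_zero, zero_mul, add_zero, hu]

theorem isEmbedding_real : IsEmbedding (LinearMap.toSpanSingleton ℝ Oct 1) where
  map_mul x y := by simp [smul_smul, mul_comm]
  map_star x := by
    simp only [LinearMap.toSpanSingleton_apply, star_trivial]
    rw [star_eq, inner_smul_right, inner_one_one]; module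
  inner_map x y := by
    rw [LinearMap.toSpanSingleton_apply, LinearMap.toSpanSingleton_apply, inner_smul_left,
      inner_smul_right, inner_one_one]
    simp [mul_comm]
  one_mem := ⟨1, by simp⟩

theorem exists_unit_orthogonal {A : Type} [NormedAddCommGroup A] [InnerProductSpace ℝ A]
    [FiniteDimensional ℝ A] (φ : A →ₗ[ℝ] Oct) (h : Module.finrank ℝ A < 8) :
    ∃ c : Oct, ‖c‖ = 1 ∧ ∀ x, inner ℝ (φ x) c = 0 := by
  have h1 : Module.finrank ℝ (LinearMap.range φ) < Module.finrank ℝ Oct := by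
    rw [finrank_oct]; exact (LinearMap.finrank_range_le φ).trans_lt h
  have h2 : (LinearMap.range φ)ᗮ ≠ ⊥ := by
    intro h3
    rw [Submodule.orthogonal_eq_bot_iff] at h3
    rw [h3, finrank_top] at h1
    exact lt_irrefl _ h1
  obtain ⟨c, hc, hc0⟩ := Submodule.exists_mem_ne_zero_of_ne_bot h2
  refine ⟨‖c‖⁻¹ • c, by rw [norm_smul, norm_inv, norm_norm, inv_mul_cancel₀ (norm_ne_zero_iff.2 hc0)], ?_⟩
  intro x
  rw [inner_smul_right, (Submodule.mem_orthogonal _ _).1 hc _ ⟨x, rfl⟩, mul_zero]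

/-- Three doublings, starting from the real line and adjoining `a`, `b` and any further unit vector
orthogonal to the quaternions they generate, embed the octonions in themselves. -/
theorem exists_isEmbedding {a b : Oct} (ha : inner ℝ 1 a = 0) (hb : inner ℝ 1 b = 0)
    (ha1 : ‖a‖ = 1) (hb1 : ‖b‖ = 1) (hab : inner ℝ a b = 0) :
    ∃ ψ : Oct →ₗ[ℝ] Oct, IsEmbedding ψ ∧ ψ (octBasis 1) = a ∧ ψ (octBasis 2) = b := by
  have h1 := isEmbedding_real.extend ha1
    (fun x => by rw [LinearMap.toSpanSingleton_apply, inner_smul_left, ha, mul_zero])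
  have h2 := h1.extend hb1 (fun x => by
    simp only [Oct.extend, LinearMap.coe_mk, AddHom.coe_mk, LinearMap.toSpanSingleton_apply,
      smul_mul_assoc, one_mul, inner_add_left, inner_smul_left, hb, hab, mul_zero, add_zero])
  obtain ⟨c, hc1, hc⟩ := exists_unit_orthogonal (Oct.extend (Oct.extend
    (LinearMap.toSpanSingleton ℝ Oct 1) a) b) (by simp [CD.finrank_eq])
  refine ⟨_, h2.extend hc1 hc, ?_, ?_⟩
  · simp [Oct.extend, octBasis]
  · simp [Oct.extend, octBasis]

theorem exists_mem_G2 {a b : Oct} (ha : inner ℝ 1 a = 0) (hb : inner ℝ 1 b = 0)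
    (ha1 : ‖a‖ = 1) (hb1 : ‖b‖ = 1) (hab : inner ℝ a b = 0) :
    ∃ h : G2, (h : Oct ≃ₗ[ℝ] Oct) (octBasis 1) = a ∧ (h : Oct ≃ₗ[ℝ] Oct) (octBasis 2) = b := by
  obtain ⟨ψ, hψ, h1, h2⟩ := exists_isEmbedding ha hb ha1 hb1 hab
  have hinj : Function.Injective ψ := by
    rw [← LinearMap.ker_eq_bot, LinearMap.ker_eq_bot']
    intro x hx
    have := hψ.inner_map x x
    rw [hx, inner_zero_left] at this
    exact inner_self_eq_zero.1 this.symm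
  exact ⟨⟨LinearEquiv.ofInjectiveEndo ψ hinj, hψ.map_mul⟩, h1, h2⟩

end Oct

/-! ### Octonion automorphisms are isometries -/

namespace G2

variable (h : G2)

theorem map_mul (x y : Oct) :
    (h : Oct ≃ₗ[ℝ] Oct) (x * y) = (h : Oct ≃ₗ[ℝ] Oct) x * (h : Oct ≃ₗ[ℝ] Oct) y := h.2 x y

theorem map_one : (h : Oct ≃ₗ[ℝ] Oct) 1 = 1 := by
  have h1 := map_mul h 1 ((h : Oct ≃ₗ[ℝ] Oct).symm 1)
  rw [one_mul, LinearEquiv.apply_symm_apply, mul_one] at h1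
  exact h1.symm

/-- Imaginary octonions are those with non-positive real square, so automorphisms preserve them
and their norms. -/
theorem map_imag {x : Oct} (hx : inner ℝ 1 x = 0) :
    inner ℝ 1 ((h : Oct ≃ₗ[ℝ] Oct) x) = 0 ∧ ‖(h : Oct ≃ₗ[ℝ] Oct) x‖ = ‖x‖ := by
  have sq : ∀ z : Oct, z * z = (2 * inner ℝ 1 z) • z - (inner ℝ z z) • (1 : Oct) := by
    intro z
    have h1 := Oct.star_mul_mul z 1
    rw [mul_one, Oct.star_eq, sub_mul, smul_mul_assoc, one_mul] at h1
    rw [← h1]; abel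
  set y := (h : Oct ≃ₗ[ℝ] Oct) x with hy
  have hyy : y * y = -(inner ℝ x x) • (1 : Oct) := by
    rw [hy, ← map_mul, sq, hx, mul_zero, zero_smul, zero_sub, map_neg, map_smul, map_one, neg_smul]
  have h1 : (2 * inner ℝ 1 y) • y = (inner ℝ y y - inner ℝ x x) • (1 : Oct) := by
    have := (sq y).symm.trans hyy
    rw [sub_eq_iff_eq_add] at this
    rw [this]; module
  have himag : inner ℝ 1 y = 0 := by
    by_contra h0
    -- otherwise `h x` would be real, hence so would `x`
    have h2 : y = ((2 * inner ℝ 1 y)⁻¹ * (inner ℝ y y - inner ℝ x x)) • (1 : Oct) := by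
      rw [mul_smul, ← h1, smul_smul, inv_mul_cancel₀ (by simpa using h0), one_smul]
    generalize (2 * inner ℝ 1 y)⁻¹ * (inner ℝ y y - inner ℝ x x) = r at h2
    have h3 : x = r • (1 : Oct) := by
      apply (h : Oct ≃ₗ[ℝ] Oct).injective
      rw [map_smul, map_one, ← h2]
    rw [h3, inner_smul_right, Oct.inner_one_one, mul_one] at hx
    rw [h2, hx, zero_smul, inner_zero_right] at h0
    exact h0 rfl
  refine ⟨himag, ?_⟩
  have h2 := congrArg (inner ℝ (1 : Oct)) h1
  rw [himag, mul_zero, zero_smul, inner_zero_right, inner_smul_right, Oct.inner_one_one, mul_one,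
    real_inner_self_eq_norm_sq, real_inner_self_eq_norm_sq] at h2
  rw [← sq_eq_sq₀ (norm_nonneg _) (norm_nonneg _)]
  linarith

theorem inner_one_map (x : Oct) : inner ℝ 1 ((h : Oct ≃ₗ[ℝ] Oct) x) = inner ℝ 1 x := by
  have h1 : inner ℝ 1 (x - (inner ℝ 1 x) • (1 : Oct)) = 0 := by
    rw [inner_sub_right, inner_smul_right, Oct.inner_one_one]; ring
  have h2 := (map_imag h h1).1
  rw [map_sub, map_smul, map_one, inner_sub_right, inner_smul_right, Oct.inner_one_one] at h2
  linarith

theorem norm_map (x : Oct) : ‖(h : Oct ≃ₗ[ℝ] Oct) x‖ = ‖x‖ := by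
  have h1 : inner ℝ 1 (x - (inner ℝ 1 x) • (1 : Oct)) = 0 := by
    rw [inner_sub_right, inner_smul_right, Oct.inner_one_one]; ring
  have key : ∀ z : Oct, inner ℝ z z = inner ℝ (z - (inner ℝ 1 z) • (1 : Oct))
      (z - (inner ℝ 1 z) • (1 : Oct)) + inner ℝ 1 z ^ 2 := by
    intro z
    simp only [inner_sub_left, inner_sub_right, inner_smul_left, inner_smul_right,
      Oct.inner_one_one, real_inner_comm 1 z, conj_trivial]
    ring
  have h2 := (map_imag h h1).2
  rw [map_sub, map_smul, map_one] at h2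
  rw [← sq_eq_sq₀ (norm_nonneg _) (norm_nonneg _), ← real_inner_self_eq_norm_sq,
    ← real_inner_self_eq_norm_sq, key, key x, inner_one_map, real_inner_self_eq_norm_sq, h2,
    real_inner_self_eq_norm_sq]

theorem inner_map (x y : Oct) :
    inner ℝ ((h : Oct ≃ₗ[ℝ] Oct) x) ((h : Oct ≃ₗ[ℝ] Oct) y) = inner ℝ x y := by
  rw [real_inner_eq_norm_add_mul_self_sub_norm_mul_self_sub_norm_mul_self_div_two,
    real_inner_eq_norm_add_mul_self_sub_norm_mul_self_sub_norm_mul_self_div_two, ← map_add,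
    norm_map, norm_map, norm_map]

theorem map_star (x : Oct) :
    (h : Oct ≃ₗ[ℝ] Oct) (star x) = star ((h : Oct ≃ₗ[ℝ] Oct) x) := by
  rw [Oct.star_eq, Oct.star_eq, map_sub, map_smul, map_one, inner_one_map]

end G2

theorem fst_g2Act (h : G2) (x : Sed) : (g2Act h x).fst = (h : Oct ≃ₗ[ℝ] Oct) x.fst := rfl
theorem snd_g2Act (h : G2) (x : Sed) : (g2Act h x).snd = (h : Oct ≃ₗ[ℝ] Oct) x.snd := rfl

theorem g2Act_mul (h : G2) (x y : Sed) : g2Act h (x * y) = g2Act h x * g2Act h y := by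
  apply CD.ext
  · rw [CD.fst_mul, fst_g2Act, CD.fst_mul, map_sub, G2.map_mul, G2.map_mul, G2.map_star]; rfl
  · rw [CD.snd_mul, snd_g2Act, CD.snd_mul, map_add, G2.map_mul, G2.map_mul, G2.map_star]; rfl

theorem inner_g2Act (h : G2) (x y : Sed) : inner ℝ (g2Act h x) (g2Act h y) = inner ℝ x y := by
  rw [CD.inner_def, CD.inner_def x, fst_g2Act, fst_g2Act, snd_g2Act, snd_g2Act, G2.inner_map,
    G2.inner_map]

theorem norm_g2Act (h : G2) (x : Sed) : ‖g2Act h x‖ = ‖x‖ := by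
  rw [← sq_eq_sq₀ (norm_nonneg _) (norm_nonneg _), ← real_inner_self_eq_norm_sq, inner_g2Act,
    real_inner_self_eq_norm_sq]

/-! ### The Stiefel manifold as an orbit and as the set of zero divisors -/

theorem inner_octBasis (i j : Fin 8) :
    inner ℝ (octBasis i) (octBasis j) = if i = j then 1 else 0 := by
  fin_cases i <;> fin_cases j <;> simp [octBasis, CD.inner_def, -inner_self_eq_norm_sq_to_K]

theorem stiefelBase_mem : stiefelBase ∈ stiefel := by
  refine ⟨?_, ?_, ?_, ?_, ?_⟩
  · change IsImag (octBasis 1)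
    rw [Oct.isImag_iff, Oct.one_def, inner_octBasis]; simp
  · change IsImag (octBasis 2)
    rw [Oct.isImag_iff, Oct.one_def, inner_octBasis]; simp
  · change ‖octBasis 1‖ = 1
    rw [norm_eq_sqrt_real_inner, inner_octBasis]; simp
  · change ‖octBasis 2‖ = 1
    rw [norm_eq_sqrt_real_inner, inner_octBasis]; simp
  · change inner ℝ (octBasis 1) (octBasis 2) = 0
    rw [inner_octBasis]; simp

theorem stiefel_eq_orbit : stiefel = {p : Sed | ∃ h : G2, g2Act h stiefelBase = p} := by
  ext p
  constructor
  · rintro ⟨h1, h2, h3, h4, h5⟩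
    obtain ⟨h, ha, hb⟩ := Oct.exists_mem_G2 ((Oct.isImag_iff _).1 h1) ((Oct.isImag_iff _).1 h2) h3 h4 h5
    exact ⟨h, CD.ext ha hb⟩
  · rintro ⟨h, rfl⟩
    obtain ⟨h1, h2, h3, h4, h5⟩ := stiefelBase_mem
    rw [Oct.isImag_iff] at h1 h2
    refine ⟨?_, ?_, ?_, ?_, ?_⟩
    · rw [Oct.isImag_iff, fst_g2Act, G2.inner_one_map, h1]
    · rw [Oct.isImag_iff, snd_g2Act, G2.inner_one_map, h2]
    · rw [fst_g2Act, G2.norm_map, h3]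
    · rw [snd_g2Act, G2.norm_map, h4]
    · rw [fst_g2Act, snd_g2Act, G2.inner_map, h5]

/-- A zero divisor partner of the base point; its `G₂`-translates serve the other points. -/
theorem stiefelBase_mul : stiefelBase * CD.mk (octBasis 7) (octBasis 4) = 0 := by
  ext <;> simp [stiefelBase, octBasis, CD.fst_mul, CD.snd_mul, CD.fst_star, CD.snd_star]

/-- The algebraic core of the description of sedenion zero divisors: if two units `a`, `b`
annihilate some unit `d` in the sense that `a (d b) + (a d) b = 0`, then they are imaginary and
orthogonal. Each equation arises by pairing the hypothesis with a suitable vector. -/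
theorem Oct.imag_of_mul_mul_add {a b d : Oct} (ha : ‖a‖ = 1) (hb : ‖b‖ = 1) (hd : ‖d‖ = 1)
    (h : a * (d * b) + (a * d) * b = 0) :
    inner ℝ 1 a = 0 ∧ inner ℝ 1 b = 0 ∧ inner ℝ a b = 0 := by
  have haa : inner ℝ a a = 1 := by rw [real_inner_self_eq_norm_sq, ha, one_pow]
  have hbb : inner ℝ b b = 1 := by rw [real_inner_self_eq_norm_sq, hb, one_pow]
  have hdd : inner ℝ d d = 1 := by rw [real_inner_self_eq_norm_sq, hd, one_pow]
  have skew_left : ∀ x y : Oct, inner ℝ (x * y) y = inner ℝ y y * inner ℝ 1 x := fun x y => by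
    have := inner_mul_mul_right x 1 y
    rw [(by rwa [one_mul] at this : inner ℝ (x * y) y = inner ℝ y y * inner ℝ x 1), real_inner_comm 1 x]
  have skew_right : ∀ x y : Oct, inner ℝ (y * x) y = inner ℝ y y * inner ℝ 1 x := fun x y => by
    have := inner_mul_mul_left y x 1
    rw [(by rwa [mul_one] at this : inner ℝ (y * x) y = inner ℝ y y * inner ℝ x 1), real_inner_comm 1 x]
  have hpair : ∀ z, inner ℝ (a * (d * b)) z + inner ℝ ((a * d) * b) z = 0 := fun z => by
    rw [← inner_add_left, h, inner_zero_left]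
  have h1 : inner ℝ 1 a = 0 := by
    have := hpair (d * b)
    rw [skew_left, inner_mul_mul_right, inner_mul_mul_right, skew_left, hdd, hbb] at this
    linarith
  have h2 : inner ℝ 1 b = 0 := by
    have := hpair (a * d)
    rw [skew_right, inner_mul_mul_left, inner_mul_mul_left, skew_right, hdd, haa] at this
    linarith
  have hsa : star a = -a := (isImag_iff a).2 h1
  have hsb : star b = -b := (isImag_iff b).2 h2
  have h3 : inner ℝ (a * d) (d * b) = 0 := by
    have := hpair d
    have hl : inner ℝ (a * (d * b)) d = -inner ℝ (a * d) (d * b) := by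
      rw [inner_mul_left, hsa, neg_mul, inner_neg_right, real_inner_comm]
    have hr : inner ℝ ((a * d) * b) d = -inner ℝ (a * d) (d * b) := by
      rw [inner_mul_right, hsb, mul_neg, inner_neg_right]
    rw [hl, hr] at this
    linarith
  have h4 : inner ℝ b d = 0 := by
    have := hpair a
    have hba : inner ℝ (a * (d * b)) a = inner ℝ (d * b) 1 := by
      have := inner_mul_mul_left a (d * b) 1
      rwa [mul_one, haa, one_mul] at this
    rw [hba, inner_mul_right _ b a, inner_mul_right, one_mul, hsb, mul_neg, inner_neg_right,
      inner_neg_right, inner_mul_mul_left, haa, real_inner_comm] at this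
    linarith
  have h5 : inner ℝ (d * b) a = 0 := by
    have := hpair 1
    have hl : inner ℝ (a * (d * b)) 1 = -inner ℝ (d * b) a := by
      rw [inner_mul_left, hsa, mul_one, inner_neg_right]
    have hr : inner ℝ ((a * d) * b) 1 = -inner ℝ (d * b) a := by
      rw [inner_mul_right, one_mul, inner_mul_left, inner_mul_right, hsa, hsb, neg_mul, mul_neg]
      simp
    rw [hl, hr] at this
    linarith
  have h6 : inner ℝ 1 (d * b) = 0 := by
    rw [real_inner_comm, inner_mul_right, one_mul, hsb, inner_neg_right, real_inner_comm, h4,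
      neg_zero]
  -- rewriting `a d` through the conjugate of `d`, the pairing `h3` becomes `-⟪d a, d b⟫`
  have h7 : a * d = (2 * inner ℝ 1 (a * d)) • (1 : Oct) + (2 * inner ℝ 1 d) • a - d * a := by
    have e1 := star_eq (a * d)
    rw [star_mul, hsa, star_eq d, mul_neg, sub_mul, smul_mul_assoc, one_mul] at e1
    rw [eq_sub_iff_add_eq, ← eq_sub_iff_add_eq'] at e1
    exact e1.trans (by abel)
  rw [h7, inner_sub_left, inner_add_left, inner_smul_left, inner_smul_left, h6,
    real_inner_comm (d * b) a, h5, inner_mul_mul_left, hdd] at h3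
  refine ⟨h1, h2, ?_⟩
  simpa using h3

theorem stiefel_eq_sedZeroDivisors : stiefel = sedZeroDivisors := by
  ext u
  constructor
  · intro hu
    rw [stiefel_eq_orbit] at hu
    obtain ⟨h, rfl⟩ := hu
    have hn : ∀ x : Sed, ‖x.fst‖ = 1 → ‖x.snd‖ = 1 → ‖x‖ = √2 := fun x h1 h2 => by
      rw [eq_comm, Real.sqrt_eq_iff_mul_self_eq (by norm_num) (norm_nonneg _), ← sq,
        CD.norm_sq_def, h1, h2]
      norm_num
    have h1 : ∀ i, ‖octBasis i‖ = 1 := fun i => by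
      rw [norm_eq_sqrt_real_inner, inner_octBasis, if_pos rfl, Real.sqrt_one]
    refine ⟨g2Act h (CD.mk (octBasis 7) (octBasis 4)), ?_, ?_, ?_⟩
    · rw [norm_g2Act]; exact hn _ (h1 1) (h1 2)
    · rw [norm_g2Act]; exact hn _ (h1 7) (h1 4)
    · rw [← g2Act_mul, stiefelBase_mul, map_zero]
  · rintro ⟨v, hu, hv, huv⟩
    have hu2 : ‖u.fst‖ ^ 2 + ‖u.snd‖ ^ 2 = 2 := by rw [← CD.norm_sq_def, hu]; norm_num
    have hv2 : ‖v.fst‖ ^ 2 + ‖v.snd‖ ^ 2 = 2 := by rw [← CD.norm_sq_def, hv]; norm_num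
    have e1 : u.fst * v.fst = star v.snd * u.snd := sub_eq_zero.1 (congrArg CD.fst huv)
    have e2 : v.snd * u.fst = -(u.snd * star v.fst) :=
      eq_neg_of_add_eq_zero_left (congrArg CD.snd huv)
    have n1 := congrArg norm e1
    have n2 := congrArg norm e2
    rw [Oct.norm_mul, Oct.norm_mul, Oct.norm_star] at n1
    rw [norm_neg, Oct.norm_mul, Oct.norm_mul, Oct.norm_star] at n2
    generalize ha : ‖u.fst‖ = a at *
    generalize hb : ‖u.snd‖ = b at *
    generalize hc : ‖v.fst‖ = c at *
    generalize hd : ‖v.snd‖ = d at *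
    have ha0 : 0 ≤ a := ha ▸ norm_nonneg _
    have hb0 : 0 ≤ b := hb ▸ norm_nonneg _
    have hd0 : 0 ≤ d := hd ▸ norm_nonneg _
    have hab : a ^ 2 = b ^ 2 := by
      have : a ^ 2 * (c ^ 2 + d ^ 2) = b ^ 2 * (c ^ 2 + d ^ 2) := by
        linear_combination (a * c + d * b) * n1 + (d * a + b * c) * n2
      rw [hv2] at this
      linarith
    have ha1 : a = 1 := by nlinarith
    have hb1 : b = 1 := by nlinarith
    have hd1 : d = 1 := by
      rw [ha1, hb1, one_mul, mul_one] at n1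
      rw [n1] at hv2
      nlinarith
    subst ha1 hb1 hd1
    -- solving both equations for the first component of `v` eliminates it
    have f1 := Oct.star_mul_mul u.fst v.fst
    rw [real_inner_self_eq_norm_sq, ha, one_pow, one_smul, e1] at f1
    have f2 := congrArg star (Oct.star_mul_mul u.snd (star v.fst))
    rw [real_inner_self_eq_norm_sq, hb, one_pow, one_smul, Oct.star_star,
      ← neg_eq_iff_eq_neg.2 e2, Oct.star_mul, Oct.star_star, Oct.star_neg, Oct.star_mul,
      neg_mul] at f2
    obtain ⟨g1, g2, g3⟩ := Oct.imag_of_mul_mul_add (a := star u.fst) (b := u.snd)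
      (d := star v.snd) (by rw [Oct.norm_star, ha]) hb (by rw [Oct.norm_star, hd])
      (by rw [f1, ← f2]; abel)
    rw [← Oct.star_one, Oct.inner_star_star, ← Oct.isImag_iff] at g1
    rw [← Oct.isImag_iff] at g2
    have g1' : star u.fst = -u.fst := g1
    rw [g1', inner_neg_left, neg_eq_zero] at g3
    exact ⟨g1, g2, ha, hb, g3⟩

/-! ### Levi-Civita connections of submanifolds -/

section Submanifold

variable {E : Type} [NormedAddCommGroup E] [InnerProductSpace ℝ E] {M : Set E}
  {g g' : E → E →L[ℝ] E →L[ℝ] ℝ} {D D' : (E → E) → (E → E) → E → E} {p : E}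

theorem fderiv_eq_of_eqOn_of_mem_tangentSpaceOf {G : Type} [NormedAddCommGroup G] [NormedSpace ℝ G]
    {f f' : E → G} (hf : DifferentiableAt ℝ f p) (hf' : DifferentiableAt ℝ f' p)
    (h : ∀ q ∈ M, f q = f' q) {v : E} (hv : v ∈ tangentSpaceOf M p) :
    fderiv ℝ f p v = fderiv ℝ f' p v := by
  refine Submodule.span_induction (p := fun v _ => fderiv ℝ f p v = fderiv ℝ f' p v)
    ?_ ?_ ?_ ?_ hv
  · rintro v ⟨γ, hγ, hM, rfl, rfl⟩
    have hd : HasDerivAt γ (deriv γ 0) 0 := (hγ.differentiable (by simp) 0).hasDerivAt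
    have h1 := hf.hasFDerivAt.comp_hasDerivAt 0 hd
    have h2 := hf'.hasFDerivAt.comp_hasDerivAt 0 hd
    have h3 : f ∘ γ = f' ∘ γ := funext fun t => h _ (hM t)
    rw [h3] at h1
    exact h1.unique h2
  · simp
  · intro x y _ _ hx hy
    rw [map_add, map_add, hx, hy]
  · intro a x _ hx
    rw [map_smul, map_smul, hx]

theorem hasDerivAt_line (p v : E) : HasDerivAt (fun t : ℝ => p + t • v) v 0 := by
  simpa using ((hasDerivAt_id (0 : ℝ)).smul_const v).const_add p

theorem hasDerivAt_comp_line {G : Type} [NormedAddCommGroup G] [NormedSpace ℝ G] {f : E → G}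
    (hf : DifferentiableAt ℝ f p) (v : E) :
    HasDerivAt (fun t : ℝ => f (p + t • v)) (fderiv ℝ f p v) 0 := by
  have h2 : HasFDerivAt f (fderiv ℝ f p) (p + (0 : ℝ) • v) := by
    rw [zero_smul, add_zero]; exact hf.hasFDerivAt
  exact h2.comp_hasDerivAt 0 (hasDerivAt_line p v)

theorem eq_zero_of_eqOn_const_of_hasDerivAt_line {f : E → ℝ} {r f' : ℝ} (hM : ∀ q ∈ M, f q = r)
    (hf : ContDiff ℝ ∞ f) {v : E} (hv : v ∈ tangentSpaceOf M p)
    (hd : HasDerivAt (fun t : ℝ => f (p + t • v)) f' 0) : f' = 0 := by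
  have hf' : DifferentiableAt ℝ f p := hf.differentiable (by simp) p
  rw [hd.unique (hasDerivAt_comp_line hf' v), fderiv_eq_of_eqOn_of_mem_tangentSpaceOf hf'
    (differentiableAt_const r) hM hv]
  simp

/-- Uniqueness of the Levi-Civita connection. The difference of two such connections is symmetric
in its arguments and skew with respect to the metric, hence zero. -/
theorem IsLeviCivita.eq (hg : IsRiemannianMetric M g)
    (hext : ∀ p ∈ M, ∀ v ∈ tangentSpaceOf M p, ∃ Z, IsVectorField M Z ∧ Z p = v)
    (hD : IsLeviCivita M g D) (hD' : IsLeviCivita M g D') {X Y : E → E}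
    (hX : IsVectorField M X) (hY : IsVectorField M Y) (hp : p ∈ M) : D X Y p = D' X Y p := by
  have htan : ∀ {X Y}, IsVectorField M X → IsVectorField M Y →
      D X Y p - D' X Y p ∈ tangentSpaceOf M p := fun hX hY =>
    Submodule.sub_mem _ ((hD.isVectorField _ _ hX hY).2 p hp) ((hD'.isVectorField _ _ hX hY).2 p hp)
  have hsymm : ∀ {X Y}, IsVectorField M X → IsVectorField M Y →
      D X Y p - D' X Y p = D Y X p - D' Y X p := fun hX hY => by
    have h1 := hD.torsion_free _ _ hX hY p hp
    have h2 := hD'.torsion_free _ _ hX hY p hp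
    rw [← h2, sub_eq_sub_iff_add_eq_add] at h1
    rw [sub_eq_sub_iff_add_eq_add, h1, add_comm]
  have hskew : ∀ {X Y Z}, IsVectorField M X → IsVectorField M Y → IsVectorField M Z →
      g p (D X Y p - D' X Y p) (Z p) = - g p (D X Z p - D' X Z p) (Y p) := fun hX hY hZ => by
    have h1 := hD.metric _ _ _ hX hY hZ p hp
    have h2 := hD'.metric _ _ _ hX hY hZ p hp
    rw [hg.symm p hp _ (htan hX hZ) _ (hY.2 p hp)]
    simp only [map_sub, sub_apply]
    linarith
  obtain ⟨Z, hZ, hZp⟩ := hext p hp _ (htan hX hY)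
  have h0 : g p (D X Y p - D' X Y p) (Z p) = 0 := by
    have h1 := hskew hX hY hZ
    rw [hsymm hX hZ, hskew hZ hX hY, hsymm hZ hY, hskew hY hZ hX, hsymm hY hX] at h1
    linarith
  by_contra hne
  rw [hZp] at h0
  exact (hg.pos p hp _ (htan hX hY) (sub_ne_zero.2 hne)).ne' h0

theorem IsLeviCivita.leviCivita_eq (hg : IsRiemannianMetric M g)
    (hext : ∀ p ∈ M, ∀ v ∈ tangentSpaceOf M p, ∃ Z, IsVectorField M Z ∧ Z p = v)
    (hD : IsLeviCivita M g D) {X Y : E → E}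
    (hX : IsVectorField M X) (hY : IsVectorField M Y) (hp : p ∈ M) :
    leviCivita M g X Y p = D X Y p := by
  have h : ∃ D, IsLeviCivita M g D := ⟨D, hD⟩
  have h1 : leviCivita M g = h.choose := dif_pos h
  rw [h1]
  exact h.choose_spec.eq hg hext hD hX hY hp

theorem IsLeviCivita.isVectorField_leviCivita (hD : IsLeviCivita M g D) {X Y : E → E}
    (hX : IsVectorField M X) (hY : IsVectorField M Y) : IsVectorField M (leviCivita M g X Y) := by
  have h : ∃ D, IsLeviCivita M g D := ⟨D, hD⟩
  have h1 : leviCivita M g = h.choose := dif_pos h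
  rw [h1]
  exact h.choose_spec.isVectorField X Y hX hY

theorem contDiff_fderiv_apply {X Y : E → E} (hX : ContDiff ℝ ∞ X) (hY : ContDiff ℝ ∞ Y) :
    ContDiff ℝ ∞ fun q => fderiv ℝ Y q (X q) :=
  (hY.fderiv_right (by simp)).clm_apply hX

theorem IsLeviCivita.isVectorField_lieBracket (hD : IsLeviCivita M g D) {X Y : E → E}
    (hX : IsVectorField M X) (hY : IsVectorField M Y) :
    IsVectorField M (VectorField.lieBracket ℝ X Y) := by
  refine ⟨(contDiff_fderiv_apply hX.1 hY.1).sub (contDiff_fderiv_apply hY.1 hX.1), ?_⟩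
  intro p hp
  rw [← hD.torsion_free X Y hX hY p hp]
  exact Submodule.sub_mem _ ((hD.isVectorField _ _ hX hY).2 p hp)
    ((hD.isVectorField _ _ hY hX).2 p hp)

/-- Being the Levi-Civita connection depends only on the values of the metric along `M`. -/
theorem IsLeviCivita.congr (hg : ContDiff ℝ ∞ g) (hg' : ContDiff ℝ ∞ g')
    (h : ∀ p ∈ M, ∀ x ∈ tangentSpaceOf M p, ∀ y ∈ tangentSpaceOf M p, g p x y = g' p x y)
    (hD : IsLeviCivita M g D) : IsLeviCivita M g' D := by
  refine { hD with metric := fun X Y Z hX hY hZ p hp => ?_ }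
  have hd : ∀ {g : E → E →L[ℝ] E →L[ℝ] ℝ}, ContDiff ℝ ∞ g →
      DifferentiableAt ℝ (fun q => g q (Y q) (Z q)) p := fun hg =>
    (((hg.clm_apply hY.1).clm_apply hZ.1).differentiable (by simp)) p
  rw [← h p hp _ ((hD.isVectorField X Y hX hY).2 p hp) _ (hZ.2 p hp),
    ← h p hp _ (hY.2 p hp) _ ((hD.isVectorField X Z hX hZ).2 p hp), ← hD.metric X Y Z hX hY hZ p hp]
  exact fderiv_eq_of_eqOn_of_mem_tangentSpaceOf (hd hg') (hd hg)
    (fun q hq => (h q hq _ (hY.2 q hq) _ (hZ.2 q hq)).symm) (hX.2 p hp)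

end Submanifold

/-! ### Calculus on pairs -/

namespace CD

variable {F : Type} [NormedAddCommGroup F] [InnerProductSpace ℝ F]

/-- The pair map as a continuous linear equivalence. -/
def equivProd : CD F ≃L[ℝ] F × F := WithLp.prodContinuousLinearEquiv 2 ℝ F F

/-- The first component as a continuous linear map. -/
def fstL : CD F →L[ℝ] F := (ContinuousLinearMap.fst ℝ F F).comp equivProd.toContinuousLinearMap

/-- The second component as a continuous linear map. -/
def sndL : CD F →L[ℝ] F := (ContinuousLinearMap.snd ℝ F F).comp equivProd.toContinuousLinearMap

/-- The rotation `(a, b) ↦ (-b, a)`. -/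
def rot : CD F →L[ℝ] CD F :=
  (equivProd (F := F)).symm.toContinuousLinearMap.comp ((-sndL).prod fstL)

@[simp] theorem fst_rot (x : CD F) : (rot x).fst = -x.snd := rfl
@[simp] theorem snd_rot (x : CD F) : (rot x).snd = x.fst := rfl

theorem inner_rot_left (x y : CD F) : inner ℝ (rot x) y = -inner ℝ x (rot y) := by
  simp [inner_def]

section Calculus

variable {G : Type} [NormedAddCommGroup G] [NormedSpace ℝ G]

theorem contDiff_fst {f : G → CD F} (hf : ContDiff ℝ ∞ f) : ContDiff ℝ ∞ fun t => (f t).fst :=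
  fstL.contDiff.comp hf

theorem contDiff_snd {f : G → CD F} (hf : ContDiff ℝ ∞ f) : ContDiff ℝ ∞ fun t => (f t).snd :=
  sndL.contDiff.comp hf

theorem contDiff_mk {f h : G → F} (hf : ContDiff ℝ ∞ f) (hh : ContDiff ℝ ∞ h) :
    ContDiff ℝ ∞ fun t => mk (f t) (h t) :=
  (equivProd (F := F)).symm.contDiff.comp (hf.prodMk hh)

theorem hasDerivAt_fst {f : ℝ → CD F} {f' : CD F} {t : ℝ} (hf : HasDerivAt f f' t) :
    HasDerivAt (fun t => (f t).fst) f'.fst t :=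
  fstL.hasFDerivAt.comp_hasDerivAt t hf

theorem hasDerivAt_snd {f : ℝ → CD F} {f' : CD F} {t : ℝ} (hf : HasDerivAt f f' t) :
    HasDerivAt (fun t => (f t).snd) f'.snd t :=
  sndL.hasFDerivAt.comp_hasDerivAt t hf

theorem hasDerivAt_mk {f h : ℝ → F} {f' h' : F} {t : ℝ} (hf : HasDerivAt f f' t)
    (hh : HasDerivAt h h' t) : HasDerivAt (fun t => mk (f t) (h t)) (mk f' h') t :=
  (equivProd (F := F)).symm.toContinuousLinearMap.hasFDerivAt.comp_hasDerivAt t (hf.prodMk hh)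

end Calculus

/-! ### Orthonormal pairs in a hyperplane and their tangent spaces -/

/-- The Stiefel manifold of orthonormal pairs in the hyperplane orthogonal to `e`. -/
def orthoPairs (e : F) : Set (CD F) :=
  {u | inner ℝ e u.fst = 0 ∧ inner ℝ e u.snd = 0 ∧ ‖u.fst‖ = 1 ∧ ‖u.snd‖ = 1 ∧
    inner ℝ u.fst u.snd = 0}

variable {e : F} {p : CD F}

theorem inner_fst_self (hp : p ∈ orthoPairs e) : inner ℝ p.fst p.fst = 1 := by
  rw [real_inner_self_eq_norm_sq, hp.2.2.1, one_pow]

theorem inner_snd_self (hp : p ∈ orthoPairs e) : inner ℝ p.snd p.snd = 1 := by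
  rw [real_inner_self_eq_norm_sq, hp.2.2.2.1, one_pow]

theorem inner_snd_fst (hp : p ∈ orthoPairs e) : inner ℝ p.snd p.fst = 0 := by
  rw [real_inner_comm, hp.2.2.2.2]

theorem inner_rot_self (hp : p ∈ orthoPairs e) : inner ℝ (rot p) (rot p) = 2 := by
  simp only [inner_def, fst_rot, snd_rot, inner_neg_neg, inner_fst_self hp, inner_snd_self hp]
  norm_num

/-- The linearized equations of `orthoPairs e` at `p`. -/
def IsTangent (e : F) (p v : CD F) : Prop :=
  inner ℝ e v.fst = 0 ∧ inner ℝ e v.snd = 0 ∧ inner ℝ p.fst v.fst = 0 ∧ inner ℝ p.snd v.snd = 0 ∧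
    inner ℝ p.fst v.snd + inner ℝ p.snd v.fst = 0

theorem contDiff_cos_smul_add_sin_smul {G : Type} [NormedAddCommGroup G] [NormedSpace ℝ G]
    (a b : G) : ContDiff ℝ ∞ fun t : ℝ => Real.cos t • a + Real.sin t • b :=
  (Real.contDiff_cos.smul contDiff_const).add (Real.contDiff_sin.smul contDiff_const)

theorem deriv_cos_smul_add_sin_smul {G : Type} [NormedAddCommGroup G] [NormedSpace ℝ G]
    (a b : G) : HasDerivAt (fun t : ℝ => Real.cos t • a + Real.sin t • b) b 0 := by
  have h1 := (Real.hasDerivAt_cos 0).smul_const a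
  have h2 := (Real.hasDerivAt_sin 0).smul_const b
  have h3 := h1.add h2
  simp only [Real.sin_zero, neg_zero, zero_smul, Real.cos_zero, one_smul, zero_add] at h3
  exact h3

theorem norm_cos_smul_add_sin_smul {a b : F} (ha : ‖a‖ = 1) (hb : ‖b‖ = 1)
    (hab : inner ℝ a b = 0) (t : ℝ) : ‖Real.cos t • a + Real.sin t • b‖ = 1 := by
  have h : ‖Real.cos t • a + Real.sin t • b‖ ^ 2 = 1 ^ 2 := by
    rw [norm_add_sq_real, norm_smul, norm_smul, inner_smul_left, inner_smul_right, ha, hb, hab,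
      mul_one, mul_one, Real.norm_eq_abs, Real.norm_eq_abs, sq_abs, sq_abs]
    simp
  exact (sq_eq_sq₀ (norm_nonneg _) zero_le_one).1 h

theorem rot_mem_tangentSpaceOf (hp : p ∈ orthoPairs e) :
    rot p ∈ tangentSpaceOf (orthoPairs e) p := by
  obtain ⟨h1, h2, h3, h4, h5⟩ := hp
  refine Submodule.subset_span ⟨_, contDiff_cos_smul_add_sin_smul p (rot p), fun t => ?_, by simp,
    (deriv_cos_smul_add_sin_smul _ _).deriv⟩
  have h5' := h5
  rw [real_inner_comm] at h5'
  have e1 : inner ℝ p.fst p.fst = 1 := by rw [real_inner_self_eq_norm_sq, h3, one_pow]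
  have e2 : inner ℝ p.snd p.snd = 1 := by rw [real_inner_self_eq_norm_sq, h4, one_pow]
  refine ⟨by simp [inner_add_right, inner_smul_right, h1, h2],
    by simp [inner_add_right, inner_smul_right, h1, h2], ?_, ?_, ?_⟩
  · exact norm_cos_smul_add_sin_smul (b := -p.snd) h3 (by rw [norm_neg, h4])
      (by rw [inner_neg_right, h5, neg_zero]) t
  · exact norm_cos_smul_add_sin_smul h4 h3 h5' t
  · simp only [fst_add, fst_smul, fst_rot, snd_add, snd_smul, snd_rot, inner_add_left,
      inner_add_right, inner_smul_left, inner_smul_right, inner_neg_left, h5, h5', e1, e2,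
      conj_trivial]
    ring

theorem mem_of_unit_mem {V W : Type} [NormedAddCommGroup V] [NormedSpace ℝ V] [AddCommGroup W]
    [Module ℝ W] {S : Submodule ℝ W} (L : V →ₗ[ℝ] W) {w : V} (h : w ≠ 0 → L (‖w‖⁻¹ • w) ∈ S) :
    L w ∈ S := by
  by_cases hw0 : w = 0
  · rw [hw0, map_zero]; exact S.zero_mem
  · have h2 := S.smul_mem ‖w‖ (h hw0)
    rwa [← map_smul, smul_smul, mul_inv_cancel₀ (norm_ne_zero_iff.2 hw0), one_smul] at h2

theorem mk_zero_right_mem_tangentSpaceOf (hp : p ∈ orthoPairs e) {w : F} (hw : inner ℝ e w = 0)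
    (hw1 : inner ℝ p.fst w = 0) (hw2 : inner ℝ p.snd w = 0) :
    mk w 0 ∈ tangentSpaceOf (orthoPairs e) p := by
  refine mem_of_unit_mem ((equivProd (F := F)).symm.toLinearMap ∘ₗ LinearMap.inl ℝ F F)
    fun hw0 => ?_
  change mk (‖w‖⁻¹ • w) 0 ∈ _
  have hwn : ‖‖w‖⁻¹ • w‖ = 1 := by
    rw [norm_smul, norm_inv, norm_norm, inv_mul_cancel₀ (norm_ne_zero_iff.2 hw0)]
  have hr : ∀ u : F, inner ℝ u w = 0 → inner ℝ u (‖w‖⁻¹ • w) = 0 := fun u hu => by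
    rw [inner_smul_right, hu, mul_zero]
  replace hw := hr _ hw
  replace hw1 := hr _ hw1
  replace hw2 := hr _ hw2
  generalize ‖w‖⁻¹ • w = w at *
  obtain ⟨h1, h2, h3, h4, h5⟩ := hp
  refine Submodule.subset_span ⟨fun t => mk (Real.cos t • p.fst + Real.sin t • w) p.snd,
    contDiff_mk (contDiff_cos_smul_add_sin_smul _ _) contDiff_const, fun t => ?_, ?_,
    (hasDerivAt_mk (deriv_cos_smul_add_sin_smul _ _) (hasDerivAt_const _ _)).deriv⟩
  · refine ⟨by simp [inner_add_right, inner_smul_right, h1, hw], h2,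
      norm_cos_smul_add_sin_smul h3 hwn hw1 t, h4, ?_⟩
    rw [real_inner_comm] at hw2
    simp [inner_add_left, inner_smul_left, h5, hw2]
  · ext <;> simp

theorem mk_zero_left_mem_tangentSpaceOf (hp : p ∈ orthoPairs e) {w : F} (hw : inner ℝ e w = 0)
    (hw1 : inner ℝ p.fst w = 0) (hw2 : inner ℝ p.snd w = 0) :
    mk 0 w ∈ tangentSpaceOf (orthoPairs e) p := by
  refine mem_of_unit_mem ((equivProd (F := F)).symm.toLinearMap ∘ₗ LinearMap.inr ℝ F F)
    fun hw0 => ?_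
  change mk 0 (‖w‖⁻¹ • w) ∈ _
  have hwn : ‖‖w‖⁻¹ • w‖ = 1 := by
    rw [norm_smul, norm_inv, norm_norm, inv_mul_cancel₀ (norm_ne_zero_iff.2 hw0)]
  have hr : ∀ u : F, inner ℝ u w = 0 → inner ℝ u (‖w‖⁻¹ • w) = 0 := fun u hu => by
    rw [inner_smul_right, hu, mul_zero]
  replace hw := hr _ hw
  replace hw1 := hr _ hw1
  replace hw2 := hr _ hw2
  generalize ‖w‖⁻¹ • w = w at *
  obtain ⟨h1, h2, h3, h4, h5⟩ := hp
  refine Submodule.subset_span ⟨fun t => mk p.fst (Real.cos t • p.snd + Real.sin t • w),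
    contDiff_mk contDiff_const (contDiff_cos_smul_add_sin_smul _ _), fun t => ?_, ?_,
    (hasDerivAt_mk (hasDerivAt_const _ _) (deriv_cos_smul_add_sin_smul _ _)).deriv⟩
  · refine ⟨h1, by simp [inner_add_right, inner_smul_right, h2, hw], h3,
      norm_cos_smul_add_sin_smul h4 hwn hw2 t, ?_⟩
    simp [inner_add_right, inner_smul_right, h5, hw1]
  · ext <;> simp

theorem mem_tangentSpaceOf_iff (hp : p ∈ orthoPairs e) {v : CD F} :
    v ∈ tangentSpaceOf (orthoPairs e) p ↔ IsTangent e p v := by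
  constructor
  · intro hv
    have hl1 := hasDerivAt_fst (hasDerivAt_line p v)
    have hl2 := hasDerivAt_snd (hasDerivAt_line p v)
    have c1 : ContDiff ℝ ∞ fun q : CD F => q.fst := contDiff_fst contDiff_id
    have c2 : ContDiff ℝ ∞ fun q : CD F => q.snd := contDiff_snd contDiff_id
    refine ⟨?_, ?_, ?_, ?_, ?_⟩
    · exact eq_zero_of_eqOn_const_of_hasDerivAt_line (f := fun q : CD F => inner ℝ e q.fst)
        (fun q hq => hq.1) (contDiff_const.inner ℝ c1) hv
        (by simpa using (hasDerivAt_const (0 : ℝ) e).inner ℝ hl1)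
    · exact eq_zero_of_eqOn_const_of_hasDerivAt_line (f := fun q : CD F => inner ℝ e q.snd)
        (fun q hq => hq.2.1) (contDiff_const.inner ℝ c2) hv
        (by simpa using (hasDerivAt_const (0 : ℝ) e).inner ℝ hl2)
    · have := eq_zero_of_eqOn_const_of_hasDerivAt_line (f := fun q : CD F => inner ℝ q.fst q.fst)
        (fun q hq => inner_fst_self hq)
        (c1.inner ℝ c1) hv (hl1.inner ℝ hl1)
      simp [real_inner_comm] at this
      linarith
    · have := eq_zero_of_eqOn_const_of_hasDerivAt_line (f := fun q : CD F => inner ℝ q.snd q.snd)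
        (fun q hq => inner_snd_self hq)
        (c2.inner ℝ c2) hv (hl2.inner ℝ hl2)
      simp [real_inner_comm] at this
      linarith
    · have := eq_zero_of_eqOn_const_of_hasDerivAt_line (f := fun q : CD F => inner ℝ q.fst q.snd)
        (fun q hq => hq.2.2.2.2)
        (c1.inner ℝ c2) hv (hl1.inner ℝ hl2)
      rw [real_inner_comm v.fst]
      simpa using this
  · rintro ⟨h1, h2, h3, h4, h5⟩
    have e1 := inner_fst_self hp
    have e2 := inner_snd_self hp
    have e3 := inner_snd_fst hp
    obtain ⟨g1, g2, -, -, g5⟩ := id hp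
    -- subtracting the multiple of `rot p` leaves components orthogonal to `e` and to both vectors of `p`
    have hdec : v = inner ℝ p.fst v.snd • rot p + mk (v.fst - inner ℝ p.snd v.fst • p.snd) 0 +
        mk 0 (v.snd - inner ℝ p.fst v.snd • p.fst) := by
      rw [← eq_neg_iff_add_eq_zero] at h5
      ext <;> simp [h5]
    rw [hdec]
    refine Submodule.add_mem _ (Submodule.add_mem _ (Submodule.smul_mem _ _
      (rot_mem_tangentSpaceOf hp)) (mk_zero_right_mem_tangentSpaceOf hp ?_ ?_ ?_))
      (mk_zero_left_mem_tangentSpaceOf hp ?_ ?_ ?_) <;>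
    simp [inner_sub_right, inner_smul_right, g1, g2, h1, h2, h3, h4, g5, e1, e2, e3,
      -inner_self_eq_norm_sq_to_K]

/-- Minus the second fundamental form of `orthoPairs e` at `q`: for tangent fields `Y` and `Z`, the
normal part of the flat derivative of `Z` along `Y` is `-normalForm Y Z q`. The formula is linear
in each argument and makes sense for all `q`. -/
def normalForm (y z q : CD F) : CD F :=
  mk (inner ℝ y.fst z.fst • q.fst + ((inner ℝ y.fst z.snd + inner ℝ y.snd z.fst) / 2) • q.snd)
    (((inner ℝ y.fst z.snd + inner ℝ y.snd z.fst) / 2) • q.fst + inner ℝ y.snd z.snd • q.snd)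

/-- Along `orthoPairs e` this is the orthogonal projection to the tangent space at `q`. -/
def tangentProj (e : F) (v q : CD F) : CD F :=
  mk (v.fst - inner ℝ e v.fst • e) (v.snd - inner ℝ e v.snd • e) - normalForm q v q

theorem contDiff_normalForm {G : Type} [NormedAddCommGroup G] [NormedSpace ℝ G]
    {X Y Z : G → CD F} (hX : ContDiff ℝ ∞ X) (hY : ContDiff ℝ ∞ Y) (hZ : ContDiff ℝ ∞ Z) :
    ContDiff ℝ ∞ fun t => normalForm (X t) (Y t) (Z t) := by
  have x1 := contDiff_fst hX
  have x2 := contDiff_snd hX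
  have y1 := contDiff_fst hY
  have y2 := contDiff_snd hY
  have z1 := contDiff_fst hZ
  have z2 := contDiff_snd hZ
  have s := ((x1.inner ℝ y2).add (x2.inner ℝ y1)).div_const 2
  exact contDiff_mk (((x1.inner ℝ y1).smul z1).add (s.smul z2))
    ((s.smul z1).add ((x2.inner ℝ y2).smul z2))

theorem isVectorField_tangentProj (he : ‖e‖ = 1) (v : CD F) :
    IsVectorField (orthoPairs e) (tangentProj e v) := by
  refine ⟨contDiff_const.sub (contDiff_normalForm contDiff_id contDiff_const contDiff_id), ?_⟩
  intro p hp
  rw [mem_tangentSpaceOf_iff hp]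
  have e0 : inner ℝ e e = 1 := by rw [real_inner_self_eq_norm_sq, he, one_pow]
  have e1 := inner_fst_self hp
  have e2 := inner_snd_self hp
  have e3 := inner_snd_fst hp
  obtain ⟨g1, g2, -, -, g5⟩ := id hp
  have g1' : inner ℝ p.fst e = 0 := by rw [real_inner_comm, g1]
  have g2' : inner ℝ p.snd e = 0 := by rw [real_inner_comm, g2]
  refine ⟨?_, ?_, ?_, ?_, ?_⟩ <;>
  simp only [tangentProj, normalForm, fst_mk, snd_mk, fst_sub, snd_sub, inner_sub_right,
    inner_add_right, inner_smul_right, e0, e1, e2, e3, g1, g2, g5, g1', g2'] <;> ring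

theorem tangentProj_of_isTangent {v : CD F} (hv : IsTangent e p v) : tangentProj e v p = v := by
  obtain ⟨h1, h2, h3, h4, h5⟩ := hv
  ext <;> simp [tangentProj, normalForm, h1, h2, h3, h4, h5]

theorem exists_isVectorField (he : ‖e‖ = 1) (p : CD F) (hp : p ∈ orthoPairs e) (v : CD F)
    (hv : v ∈ tangentSpaceOf (orthoPairs e) p) :
    ∃ Z, IsVectorField (orthoPairs e) Z ∧ Z p = v :=
  ⟨tangentProj e v, isVectorField_tangentProj he v,
    tangentProj_of_isTangent ((mem_tangentSpaceOf_iff hp).1 hv)⟩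

variable {c : ℝ}

/-! ### The metrics rescaled along the rotation, and their Levi-Civita connection -/

/-- The real inner product as a continuous bilinear map. -/
def innerL : CD F →L[ℝ] CD F →L[ℝ] ℝ :=
  (isBoundedBilinearMap_inner (𝕜 := ℝ) (E := CD F)).toContinuousLinearMap

theorem innerL_apply (x y : CD F) : innerL x y = inner ℝ x y := rfl

/-- The Euclidean metric plus `c η ⊗ η`, where `η(x) = ⟪rot q, x⟫` is the form dual to the
infinitesimal rotation of pairs. -/
def squashedMetric (c : ℝ) (q : CD F) : CD F →L[ℝ] CD F →L[ℝ] ℝ :=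
  innerL + c • (innerL (rot q)).smulRight (innerL (rot q))

theorem squashedMetric_apply (c : ℝ) (q x y : CD F) :
    squashedMetric c q x y = inner ℝ x y + c * (inner ℝ (rot q) x * inner ℝ (rot q) y) := by
  simp [squashedMetric, innerL_apply]

theorem contDiff_squashedMetric (c : ℝ) : ContDiff ℝ ∞ (squashedMetric (F := F) c) := by
  have h : ContDiff ℝ ∞ fun q : CD F => innerL (rot q) :=
    (innerL (F := F)).contDiff.comp rot.contDiff
  exact contDiff_const.add ((h.smulRight h).const_smul c)

theorem isRiemannianMetric_squashedMetric (hc : -(1 / 2) < c) :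
    IsRiemannianMetric (orthoPairs e) (squashedMetric c) where
  smooth := contDiff_squashedMetric c
  symm p _ x _ y _ := by
    rw [squashedMetric_apply, squashedMetric_apply, real_inner_comm, mul_comm (inner ℝ (rot p) x)]
  pos p hp x _ hx := by
    rw [squashedMetric_apply]
    have h1 : 0 < inner ℝ x x := real_inner_self_pos.2 hx
    have h2 := real_inner_mul_inner_self_le (rot p) x
    rw [inner_rot_self hp] at h2
    have h3 := mul_self_nonneg (inner ℝ (rot p) x)
    rcases le_total 0 c with h | h
    · linarith [mul_nonneg h h3]
    · linarith [mul_le_mul_of_nonpos_left h2 h, mul_pos (by linarith : 0 < 1 + 2 * c) h1]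

/-- The Christoffel form of `squashedMetric c`: the Levi-Civita connection is the flat derivative
plus this form. -/
def christoffel (c : ℝ) (q y z : CD F) : CD F :=
  normalForm y z q + c • (inner ℝ (rot q) z • rot y + inner ℝ (rot q) y • rot z +
    (inner ℝ (rot q) y * inner ℝ (rot q) z) • q)

theorem normalForm_comm (y z q : CD F) : normalForm y z q = normalForm z y q := by
  simp only [normalForm, real_inner_comm z.fst, real_inner_comm z.snd, add_comm]

theorem normalForm_add_left (x y z q : CD F) :
    normalForm (x + y) z q = normalForm x z q + normalForm y z q := by
  ext <;> simp only [normalForm, fst_mk, snd_mk, fst_add, snd_add, inner_add_left] <;> module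

theorem normalForm_smul_left (r : ℝ) (x z q : CD F) :
    normalForm (r • x) z q = r • normalForm x z q := by
  ext <;> simp only [normalForm, fst_mk, snd_mk, fst_smul, snd_smul, inner_smul_left,
    conj_trivial] <;> module

theorem christoffel_comm (c : ℝ) (q y z : CD F) : christoffel c q y z = christoffel c q z y := by
  rw [christoffel, christoffel, normalForm_comm]; module

theorem christoffel_add_left (c : ℝ) (q x y z : CD F) :
    christoffel c q (x + y) z = christoffel c q x z + christoffel c q y z := by
  simp only [christoffel, normalForm_add_left, map_add, inner_add_right]; module

theorem christoffel_smul_left (c : ℝ) (q : CD F) (r : ℝ) (x z : CD F) :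
    christoffel c q (r • x) z = r • christoffel c q x z := by
  simp only [christoffel, normalForm_smul_left, map_smul, inner_smul_right]; module

theorem christoffel_add_right (c : ℝ) (q x y z : CD F) :
    christoffel c q x (y + z) = christoffel c q x y + christoffel c q x z := by
  rw [christoffel_comm, christoffel_add_left, christoffel_comm c q y, christoffel_comm c q z]

theorem christoffel_smul_right (c : ℝ) (q : CD F) (r : ℝ) (x z : CD F) :
    christoffel c q x (r • z) = r • christoffel c q x z := by
  rw [christoffel_comm, christoffel_smul_left, christoffel_comm]

theorem christoffel_sub_left (c : ℝ) (q x y z : CD F) :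
    christoffel c q (x - y) z = christoffel c q x z - christoffel c q y z := by
  rw [eq_sub_iff_add_eq, ← christoffel_add_left, sub_add_cancel]

theorem contDiff_christoffel {Q Y Z : CD F → CD F} (hQ : ContDiff ℝ ∞ Q) (hY : ContDiff ℝ ∞ Y)
    (hZ : ContDiff ℝ ∞ Z) : ContDiff ℝ ∞ fun t => christoffel c (Q t) (Y t) (Z t) := by
  have hr : ∀ {X : CD F → CD F}, ContDiff ℝ ∞ X → ContDiff ℝ ∞ fun t => rot (X t) :=
    fun hX => rot.contDiff.comp hX
  have y1 := (hr hQ).inner ℝ hY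
  have z1 := (hr hQ).inner ℝ hZ
  exact (contDiff_normalForm hY hZ hQ).add
    ((((z1.smul (hr hY)).add (y1.smul (hr hZ))).add ((y1.mul z1).smul hQ)).const_smul c)

/-- The derivative of `q ↦ christoffel c q y z` at `q` in the direction `x`. -/
def christoffelDeriv (c : ℝ) (q x y z : CD F) : CD F :=
  normalForm y z x + c • (inner ℝ (rot x) z • rot y + inner ℝ (rot x) y • rot z +
    (inner ℝ (rot x) y * inner ℝ (rot q) z + inner ℝ (rot q) y * inner ℝ (rot x) z) • q +
    (inner ℝ (rot q) y * inner ℝ (rot q) z) • x)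

theorem hasDerivAt_normalForm {X Y Z : ℝ → CD F} {X' Y' Z' : CD F} {t : ℝ}
    (hX : HasDerivAt X X' t) (hY : HasDerivAt Y Y' t) (hZ : HasDerivAt Z Z' t) :
    HasDerivAt (fun t => normalForm (X t) (Y t) (Z t))
      (normalForm X' (Y t) (Z t) + normalForm (X t) Y' (Z t) + normalForm (X t) (Y t) Z') t := by
  have x1 := hasDerivAt_fst hX
  have x2 := hasDerivAt_snd hX
  have y1 := hasDerivAt_fst hY
  have y2 := hasDerivAt_snd hY
  have z1 := hasDerivAt_fst hZ
  have z2 := hasDerivAt_snd hZ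
  have s := ((x1.inner ℝ y2).add (x2.inner ℝ y1)).div_const 2
  have h := hasDerivAt_mk (((x1.inner ℝ y1).smul z1).add (s.smul z2))
    ((s.smul z1).add ((x2.inner ℝ y2).smul z2))
  refine h.congr_deriv ?_
  ext <;> simp only [normalForm, fst_mk, snd_mk, fst_add, snd_add, Pi.add_apply] <;> module

theorem hasDerivAt_christoffel {Q Y Z : ℝ → CD F} {Q' Y' Z' : CD F} {t : ℝ}
    (hQ : HasDerivAt Q Q' t) (hY : HasDerivAt Y Y' t) (hZ : HasDerivAt Z Z' t) :
    HasDerivAt (fun t => christoffel c (Q t) (Y t) (Z t))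
      (christoffelDeriv c (Q t) Q' (Y t) (Z t) + christoffel c (Q t) Y' (Z t) +
        christoffel c (Q t) (Y t) Z') t := by
  have hr : ∀ {X : ℝ → CD F} {X' : CD F}, HasDerivAt X X' t →
      HasDerivAt (fun t => rot (X t)) (rot X') t := fun hX => rot.hasFDerivAt.comp_hasDerivAt t hX
  have y1 := (hr hQ).inner ℝ hY
  have z1 := (hr hQ).inner ℝ hZ
  have h := (hasDerivAt_normalForm hY hZ hQ).add
    ((((z1.smul (hr hY)).add (y1.smul (hr hZ))).add ((y1.mul z1).smul hQ)).const_smul c)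
  refine h.congr_deriv ?_
  simp only [christoffelDeriv, christoffel, Pi.mul_apply]
  module

/-- The Levi-Civita connection of `squashedMetric c` on `orthoPairs e`, extended to the ambient
space. -/
def connection (c : ℝ) (X Y : CD F → CD F) (q : CD F) : CD F :=
  fderiv ℝ Y q (X q) + christoffel c q (X q) (Y q)

/-- The derivative of a tangent field satisfies the linearization of the tangency equations. -/
theorem inner_fderiv_of_isVectorField {X : CD F → CD F} (hX : IsVectorField (orthoPairs e) X)
    {v : CD F} (hv : v ∈ tangentSpaceOf (orthoPairs e) p) :
    inner ℝ e (fderiv ℝ X p v).fst = 0 ∧ inner ℝ e (fderiv ℝ X p v).snd = 0 ∧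
    inner ℝ p.fst (fderiv ℝ X p v).fst = -inner ℝ v.fst (X p).fst ∧
    inner ℝ p.snd (fderiv ℝ X p v).snd = -inner ℝ v.snd (X p).snd ∧
    inner ℝ p.fst (fderiv ℝ X p v).snd + inner ℝ p.snd (fderiv ℝ X p v).fst =
      -(inner ℝ v.fst (X p).snd + inner ℝ v.snd (X p).fst) := by
  have ht : ∀ q ∈ orthoPairs e, IsTangent e q (X q) := fun q hq =>
    (mem_tangentSpaceOf_iff hq).1 (hX.2 q hq)
  have hl1 := hasDerivAt_fst (hasDerivAt_line p v)
  have hl2 := hasDerivAt_snd (hasDerivAt_line p v)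
  have hd := hasDerivAt_comp_line (hX.1.differentiable (by simp) p) v
  have hX1 := hasDerivAt_fst hd
  have hX2 := hasDerivAt_snd hd
  have c1 : ContDiff ℝ ∞ fun q : CD F => q.fst := contDiff_fst contDiff_id
  have c2 : ContDiff ℝ ∞ fun q : CD F => q.snd := contDiff_snd contDiff_id
  have d1 := contDiff_fst hX.1
  have d2 := contDiff_snd hX.1
  refine ⟨?_, ?_, ?_, ?_, ?_⟩
  · exact eq_zero_of_eqOn_const_of_hasDerivAt_line (f := fun q : CD F => inner ℝ e (X q).fst)
        (fun q hq => (ht q hq).1)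
      (contDiff_const.inner ℝ d1) hv (by simpa using (hasDerivAt_const (0 : ℝ) e).inner ℝ hX1)
  · exact eq_zero_of_eqOn_const_of_hasDerivAt_line (f := fun q : CD F => inner ℝ e (X q).snd)
        (fun q hq => (ht q hq).2.1)
      (contDiff_const.inner ℝ d2) hv (by simpa using (hasDerivAt_const (0 : ℝ) e).inner ℝ hX2)
  · have := eq_zero_of_eqOn_const_of_hasDerivAt_line (f := fun q : CD F => inner ℝ q.fst (X q).fst)
        (fun q hq => (ht q hq).2.2.1)
      (c1.inner ℝ d1) hv (hl1.inner ℝ hX1)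
    simp only [zero_smul, add_zero] at this
    linarith
  · have := eq_zero_of_eqOn_const_of_hasDerivAt_line (f := fun q : CD F => inner ℝ q.snd (X q).snd)
        (fun q hq => (ht q hq).2.2.2.1)
      (c2.inner ℝ d2) hv (hl2.inner ℝ hX2)
    simp only [zero_smul, add_zero] at this
    linarith
  · have := eq_zero_of_eqOn_const_of_hasDerivAt_line (f := fun q : CD F => inner ℝ q.fst (X q).snd + inner ℝ q.snd (X q).fst)
      (fun q hq => (ht q hq).2.2.2.2)
      ((c1.inner ℝ d2).add (c2.inner ℝ d1)) hv ((hl1.inner ℝ hX2).add (hl2.inner ℝ hX1))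
    simp only [zero_smul, add_zero] at this
    linarith

theorem isVectorField_connection {X Y : CD F → CD F} (hX : IsVectorField (orthoPairs e) X)
    (hY : IsVectorField (orthoPairs e) Y) : IsVectorField (orthoPairs e) (connection c X Y) := by
  refine ⟨(contDiff_fderiv_apply hX.1 hY.1).add (contDiff_christoffel contDiff_id hX.1 hY.1), ?_⟩
  intro p hp
  obtain ⟨a1, a2, a3, a4, a5⟩ := inner_fderiv_of_isVectorField hY (hX.2 p hp)
  obtain ⟨x1, x2, x3, x4, x5⟩ := (mem_tangentSpaceOf_iff hp).1 (hX.2 p hp)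
  obtain ⟨y1, y2, y3, y4, y5⟩ := (mem_tangentSpaceOf_iff hp).1 (hY.2 p hp)
  rw [mem_tangentSpaceOf_iff hp]
  have e1 := inner_fst_self hp
  have e2 := inner_snd_self hp
  have e3 := inner_snd_fst hp
  obtain ⟨g1, g2, -, -, g5⟩ := id hp
  refine ⟨?_, ?_, ?_, ?_, ?_⟩ <;>
  simp only [connection, christoffel, normalForm, inner_def, fst_mk, snd_mk, fst_add, snd_add,
    fst_smul, snd_smul, fst_rot, snd_rot, inner_add_right, inner_smul_right, inner_neg_right,
    inner_neg_left, e1, e2, e3, g1, g2, g5, a1, a2, a3, a4, x1, x2, x3, x4, y1, y2, y3, y4]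
  · ring
  · ring
  · linear_combination c * inner ℝ p.snd (X p).fst * y5 - c * inner ℝ p.fst (Y p).snd * x5
  · linear_combination c * inner ℝ p.fst (Y p).snd * x5 - c * inner ℝ p.snd (X p).fst * y5
  · linear_combination a5

theorem inner_rot_christoffel (hp : p ∈ orthoPairs e) {x y : CD F} (hx : IsTangent e p x)
    (hy : IsTangent e p y) : inner ℝ (rot p) (christoffel c p x y) = 0 := by
  obtain ⟨x1, x2, x3, x4, x5⟩ := hx
  obtain ⟨y1, y2, y3, y4, y5⟩ := hy
  have e1 := inner_fst_self hp
  have e2 := inner_snd_self hp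
  have e3 := inner_snd_fst hp
  obtain ⟨g1, g2, -, -, g5⟩ := id hp
  simp only [christoffel, normalForm, inner_def, fst_mk, snd_mk,
    fst_rot, snd_rot, inner_add_right, inner_smul_right, inner_neg_right,
    inner_neg_left, e1, e2, e3, g5, x3, x4, y3, y4]
  ring

/-- The term `normalForm x y p` of the Christoffel form is normal, and so is the term proportional
to `p`; neither affects inner products with tangent vectors. -/
theorem inner_christoffel {x y z : CD F} (hz : IsTangent e p z) :
    inner ℝ (christoffel c p x y) z =
      c * (inner ℝ (rot p) y * inner ℝ (rot x) z + inner ℝ (rot p) x * inner ℝ (rot y) z) := by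
  obtain ⟨z1, z2, z3, z4, z5⟩ := hz
  simp only [christoffel, normalForm, inner_def, fst_mk, snd_mk,
    fst_rot, snd_rot, inner_add_left, inner_smul_left, inner_neg_left, z3, z4, conj_trivial]
  linear_combination ((inner ℝ x.fst y.snd + inner ℝ x.snd y.fst) / 2) * z5

/-- The connection is symmetric because the Christoffel form is. It is metric because the covariant
derivative of the form `η` along a tangent vector `x` is `⟪rot x, ·⟫`, which is skew. -/
theorem isLeviCivita_connection (c : ℝ) :
    IsLeviCivita (orthoPairs e) (squashedMetric c) (connection c) where
  isVectorField _ _ hX hY := isVectorField_connection hX hY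
  add_left X X' Y _ _ _ p _ := by
    simp only [connection, Pi.add_apply, map_add, christoffel_add_left]; abel
  smul_left f X Y _ _ _ p _ := by
    simp only [connection, map_smul, christoffel_smul_left, smul_add]
  add_right X Y Y' _ hY hY' p _ := by
    simp only [connection, Pi.add_apply, christoffel_add_right]
    rw [fderiv_add (hY.1.differentiable (by simp) p) (hY'.1.differentiable (by simp) p),
      add_apply]
    abel
  leibniz f X Y hf _ hY p _ := by
    simp only [connection, christoffel_smul_right]
    rw [fderiv_fun_smul (hf.differentiable (by simp) p) (hY.1.differentiable (by simp) p)]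
    simp only [add_apply, smul_apply, ContinuousLinearMap.smulRight_apply, smul_add]
    abel
  torsion_free X Y _ _ p _ := by
    simp only [connection, VectorField.lieBracket, christoffel_comm c p (Y p)]
    abel
  metric X Y Z hX hY hZ p hp := by
    have tX := (mem_tangentSpaceOf_iff hp).1 (hX.2 p hp)
    have tY := (mem_tangentSpaceOf_iff hp).1 (hY.2 p hp)
    have tZ := (mem_tangentSpaceOf_iff hp).1 (hZ.2 p hp)
    have hd : DifferentiableAt ℝ (fun q => squashedMetric c q (Y q) (Z q)) p :=
      (((contDiff_squashedMetric c).clm_apply hY.1).clm_apply hZ.1).differentiable (by simp) p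
    have h1 := hasDerivAt_comp_line hd (X p)
    have hYd := hasDerivAt_comp_line (hY.1.differentiable (by simp) p) (X p)
    have hZd := hasDerivAt_comp_line (hZ.1.differentiable (by simp) p) (X p)
    have hr : HasDerivAt (fun t : ℝ => rot (p + t • X p)) (rot (X p)) 0 :=
      rot.hasFDerivAt.comp_hasDerivAt 0 (hasDerivAt_line p (X p))
    have h2 := (hYd.inner ℝ hZd).add (((hr.inner ℝ hYd).mul (hr.inner ℝ hZd)).const_mul c)
    simp only [squashedMetric_apply] at h1 ⊢
    rw [h1.unique h2]
    simp only [connection, zero_smul, add_zero, inner_add_left,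
      inner_add_right, inner_rot_christoffel hp tX tY, inner_rot_christoffel hp tX tZ,
      inner_christoffel tZ, real_inner_comm (christoffel c p (X p) (Z p)) (Y p),
      inner_christoffel tY]
    rw [inner_rot_left (Z p), real_inner_comm (rot (Y p))]
    ring

/-! ### The curvature tensor -/

/-- The curvature tensor of `squashedMetric c`, in terms of the Christoffel form. -/
def curvatureForm (c : ℝ) (p x y z : CD F) : CD F :=
  christoffelDeriv c p x y z - christoffelDeriv c p y x z +
    christoffel c p x (christoffel c p y z) - christoffel c p y (christoffel c p x z)

theorem fderiv_connection_apply {X Y : CD F → CD F} (hX : ContDiff ℝ ∞ X) (hY : ContDiff ℝ ∞ Y)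
    (p v : CD F) :
    fderiv ℝ (connection c X Y) p v =
      fderiv ℝ (fderiv ℝ Y) p v (X p) + fderiv ℝ Y p (fderiv ℝ X p v) +
      (christoffelDeriv c p v (X p) (Y p) + christoffel c p (fderiv ℝ X p v) (Y p) +
        christoffel c p (X p) (fderiv ℝ Y p v)) := by
  have hd : ContDiff ℝ ∞ (connection c X Y) :=
    (contDiff_fderiv_apply hX hY).add (contDiff_christoffel contDiff_id hX hY)
  have h1 := hasDerivAt_comp_line (hd.differentiable (by simp) p) v
  have hXd := hasDerivAt_comp_line (hX.differentiable (by simp) p) v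
  have hYd := hasDerivAt_comp_line (hY.differentiable (by simp) p) v
  have hY2 : ContDiff ℝ ∞ (fderiv ℝ Y) := hY.fderiv_right (by simp)
  have hYd2 := hasDerivAt_comp_line (hY2.differentiable (by simp) p) v
  have h2 := (hYd2.clm_apply hXd).add (hasDerivAt_christoffel (c := c) (hasDerivAt_line p v) hXd hYd)
  rw [h1.unique h2]
  simp only [zero_smul, add_zero]

theorem curvature_eq (he : ‖e‖ = 1) {g : CD F → CD F →L[ℝ] CD F →L[ℝ] ℝ}
    (hg : IsRiemannianMetric (orthoPairs e) g)
    (hgc : ∀ p ∈ orthoPairs e, ∀ x ∈ tangentSpaceOf (orthoPairs e) p,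
      ∀ y ∈ tangentSpaceOf (orthoPairs e) p, g p x y = squashedMetric c p x y)
    {X Y Z : CD F → CD F} (hX : IsVectorField (orthoPairs e) X)
    (hY : IsVectorField (orthoPairs e) Y) (hZ : IsVectorField (orthoPairs e) Z)
    (hp : p ∈ orthoPairs e) :
    curvature (orthoPairs e) g X Y Z p = curvatureForm c p (X p) (Y p) (Z p) := by
  have hD : IsLeviCivita (orthoPairs e) g (connection c) :=
    (isLeviCivita_connection c).congr (contDiff_squashedMetric c) hg.smooth
      fun p hp x hx y hy => (hgc p hp x hx y hy).symm
  have hext := exists_isVectorField he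
  have hLC : ∀ {X Y}, IsVectorField (orthoPairs e) X → IsVectorField (orthoPairs e) Y →
      ∀ p ∈ orthoPairs e, leviCivita (orthoPairs e) g X Y p = connection c X Y p :=
    fun hX hY p hp => hD.leviCivita_eq hg hext hX hY hp
  have hLC2 : ∀ {X Y}, IsVectorField (orthoPairs e) X → IsVectorField (orthoPairs e) Y →
      leviCivita (orthoPairs e) g X (leviCivita (orthoPairs e) g Y Z) p =
        connection c X (connection c Y Z) p := by
    intro X Y hX hY
    have hW := hD.isVectorField_leviCivita hY hZ
    have hW' := hD.isVectorField _ _ hY hZ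
    rw [hLC hX hW p hp, connection, connection,
      fderiv_eq_of_eqOn_of_mem_tangentSpaceOf (hW.1.differentiable (by simp) p)
        (hW'.1.differentiable (by simp) p) (hLC hY hZ) (hX.2 p hp), hLC hY hZ p hp]
  have hB := hD.isVectorField_lieBracket hX hY
  have hsymm : fderiv ℝ (fderiv ℝ Z) p (X p) (Y p) = fderiv ℝ (fderiv ℝ Z) p (Y p) (X p) :=
    (hZ.1.contDiffAt.isSymmSndFDerivAt (by
      rw [minSmoothness_of_isRCLikeNormedField]; exact WithTop.coe_le_coe.2 le_top)) (X p) (Y p)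
  rw [curvature, Pi.sub_apply, Pi.sub_apply, hLC2 hX hY, hLC2 hY hX, hLC hB hZ p hp]
  have hc : ∀ X Y, connection c X Y p = fderiv ℝ Y p (X p) + christoffel c p (X p) (Y p) :=
    fun _ _ => rfl
  rw [hc X (connection c Y Z), hc Y (connection c X Z), hc (VectorField.lieBracket ℝ X Y) Z, fderiv_connection_apply hY.1 hZ.1,
    fderiv_connection_apply hX.1 hZ.1, hc Y Z, hc X Z, christoffel_add_right, christoffel_add_right, curvatureForm, hsymm,
    VectorField.lieBracket, christoffel_sub_left, map_sub]
  abel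

/-! ### Traces of the curvature tensor -/

theorem inner_curvatureForm_mk_zero_right (hp : p ∈ orthoPairs e) {x y : CD F}
    (hx : IsTangent e p x) (hy : IsTangent e p y) {w : F} (hw0 : inner ℝ e w = 0)
    (hw1 : inner ℝ p.fst w = 0) (hw2 : inner ℝ p.snd w = 0) (hw : inner ℝ w w = 1) :
    inner ℝ (mk w 0) (curvatureForm c p (mk w 0) x y) =
      inner ℝ x.fst y.fst + (c + c ^ 2) * (inner ℝ (rot p) x * inner ℝ (rot p) y)
        - inner ℝ x.fst w * inner ℝ w y.fst
        - (1 / 2 + 3 * c) * (inner ℝ x.snd w * inner ℝ w y.snd) := by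
  have ht : IsTangent e p (mk w 0) := ⟨hw0, by simp, hw1, by simp, by simp [hw2]⟩
  have htw : ∀ u v, inner ℝ (normalForm u v p) (mk 0 w) = 0 := fun u v => by
    simp [inner_def, normalForm, inner_add_left, inner_smul_left, hw1, hw2]
  have hJ : rot (mk w 0) = mk 0 w := by ext <;> simp
  have hη : inner ℝ (rot p) (mk w 0) = 0 := by simp [inner_def, hw2]
  have hpt : inner ℝ p (mk w 0) = 0 := by simp [inner_def, hw1]
  have hpJ : inner ℝ p (mk 0 w) = 0 := by simp [inner_def, hw2]
  rw [real_inner_comm]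
  simp only [curvatureForm, inner_add_left, inner_sub_left, inner_christoffel ht,
    inner_rot_christoffel hp hx hy, inner_rot_christoffel hp ht hy, hη, hJ,
    inner_rot_left (christoffel _ _ _ _)]
  simp only [christoffel, inner_add_left, htw, inner_smul_left, hη, hJ, hpJ, conj_trivial]
  simp only [christoffelDeriv, inner_add_left, inner_smul_left, conj_trivial, hpt, hη, hJ]
  simp only [inner_def, normalForm, fst_mk, snd_mk, fst_rot, snd_rot, inner_zero_left,
    inner_zero_right, inner_add_left, inner_smul_left, conj_trivial, hw, inner_neg_left,
    real_inner_comm w x.fst, real_inner_comm w x.snd]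
  rw [real_inner_comm w y.snd]
  ring

theorem inner_curvatureForm_mk_zero_left (hp : p ∈ orthoPairs e) {x y : CD F}
    (hx : IsTangent e p x) (hy : IsTangent e p y) {w : F} (hw0 : inner ℝ e w = 0)
    (hw1 : inner ℝ p.fst w = 0) (hw2 : inner ℝ p.snd w = 0) (hw : inner ℝ w w = 1) :
    inner ℝ (mk 0 w) (curvatureForm c p (mk 0 w) x y) =
      inner ℝ x.snd y.snd + (c + c ^ 2) * (inner ℝ (rot p) x * inner ℝ (rot p) y)
        - inner ℝ x.snd w * inner ℝ w y.snd
        - (1 / 2 + 3 * c) * (inner ℝ x.fst w * inner ℝ w y.fst) := by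
  have ht : IsTangent e p (mk 0 w) := ⟨by simp, hw0, by simp, hw2, by simp [hw1]⟩
  have htw : ∀ u v, inner ℝ (normalForm u v p) (mk (-w) 0) = 0 := fun u v => by
    simp [inner_def, normalForm, inner_add_left, inner_smul_left, hw1, hw2]
  have hJ : rot (mk 0 w) = mk (-w) 0 := by ext <;> simp
  have hη : inner ℝ (rot p) (mk 0 w) = 0 := by simp [inner_def, hw1]
  have hpt : inner ℝ p (mk 0 w) = 0 := by simp [inner_def, hw2]
  have hpJ : inner ℝ p (mk (-w) 0) = 0 := by simp [inner_def, hw1]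
  rw [real_inner_comm]
  simp only [curvatureForm, inner_add_left, inner_sub_left, inner_christoffel ht,
    inner_rot_christoffel hp hx hy, inner_rot_christoffel hp ht hy, hη, hJ,
    inner_rot_left (christoffel _ _ _ _)]
  simp only [christoffel, inner_add_left, htw, inner_smul_left, hη, hJ, hpJ, conj_trivial]
  simp only [christoffelDeriv, inner_add_left, inner_smul_left, conj_trivial, hpt, hη, hJ]
  simp only [inner_def, normalForm, fst_mk, snd_mk, fst_rot, snd_rot, inner_zero_left,
    inner_zero_right, inner_add_left, inner_smul_left, conj_trivial, hw, inner_neg_left,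
    inner_neg_right, real_inner_comm w x.fst, real_inner_comm w x.snd]
  rw [real_inner_comm w y.fst]
  ring

theorem inner_curvatureForm_rot (hp : p ∈ orthoPairs e) {x y : CD F}
    (hx : IsTangent e p x) (hy : IsTangent e p y) :
    inner ℝ (rot p) (curvatureForm c p (rot p) x y) =
      (1 + 2 * c) * (inner ℝ x y - inner ℝ (rot p) x * inner ℝ (rot p) y / 2) := by
  have e1 := inner_fst_self hp
  have e2 := inner_snd_self hp
  have e3 := inner_snd_fst hp
  have ht : IsTangent e p (rot p) :=
    (mem_tangentSpaceOf_iff hp).1 (rot_mem_tangentSpaceOf hp)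
  have hJ : rot (rot p) = -p := by ext <;> simp
  obtain ⟨g1, g2, -, -, g5⟩ := id hp
  obtain ⟨x1, x2, x3, x4, x5⟩ := id hx
  obtain ⟨y1, y2, y3, y4, y5⟩ := id hy
  rw [real_inner_comm]
  simp only [curvatureForm, inner_add_left, inner_sub_left, inner_christoffel ht,
    inner_rot_christoffel hp hx hy, inner_rot_christoffel hp ht hy, hJ,
    inner_rot_left (christoffel _ _ _ _)]
  simp only [christoffel, christoffelDeriv, normalForm, inner_def, fst_mk, snd_mk, fst_rot, snd_rot,
    map_neg,
    inner_add_left, inner_smul_left, conj_trivial,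
    inner_neg_left, inner_neg_right, e1, e2, e3, g5, x3, x4, y3, y4,
    real_inner_comm p.fst x.fst, real_inner_comm p.fst x.snd, real_inner_comm p.snd x.fst,
    real_inner_comm p.snd x.snd]
  linear_combination (-1 / 2) * (inner ℝ p.fst y.snd + inner ℝ p.snd y.fst) * x5

theorem exists_adapted_basis [FiniteDimensional ℝ F] (hF : Module.finrank ℝ F = 8) (he : ‖e‖ = 1)
    (hp : p ∈ orthoPairs e) :
    ∃ f : OrthonormalBasis (Fin (3 + 5)) ℝ F, f 0 = e ∧ f 1 = p.fst ∧ f 2 = p.snd := by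
  obtain ⟨g1, g2, g3, g4, g5⟩ := id hp
  -- only the first three entries matter: the family is restricted to these indices
  have hv : Orthonormal ℝ (Set.domRestrict ({0, 1, 2} : Set (Fin (3 + 5)))
      ![e, p.fst, p.snd, 0, 0, 0, 0, 0]) := by
    constructor
    · rintro ⟨i, hi⟩
      simp only [Set.mem_insert_iff, Set.mem_singleton_iff] at hi
      rcases hi with rfl | rfl | rfl <;> simpa
    · rintro ⟨i, hi⟩ ⟨j, hj⟩ hij
      simp only [Set.mem_insert_iff, Set.mem_singleton_iff] at hi hj
      rcases hi with rfl | rfl | rfl <;> rcases hj with rfl | rfl | rfl <;>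
        first
        | exact absurd rfl hij
        | simpa
        | (rw [real_inner_comm]; simpa)
  obtain ⟨f, hf⟩ := hv.exists_orthonormalBasis_extension_of_card_eq (by simp [hF])
  exact ⟨f, by simpa using hf 0 (by simp), by simpa using hf 1 (by simp),
    by simpa using hf 2 (by simp)⟩

theorem inner_natAdd_adapted (f : OrthonormalBasis (Fin (3 + 5)) ℝ F) (h0 : f 0 = e)
    (h1 : f 1 = p.fst) (h2 : f 2 = p.snd) (k : Fin 5) : inner ℝ e (f (Fin.natAdd 3 k)) = 0 ∧
      inner ℝ p.fst (f (Fin.natAdd 3 k)) = 0 ∧ inner ℝ p.snd (f (Fin.natAdd 3 k)) = 0 := by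
  rw [← h0, ← h1, ← h2]
  refine ⟨f.orthonormal.2 ?_, f.orthonormal.2 ?_, f.orthonormal.2 ?_⟩ <;>
  · intro h
    have := congrArg Fin.val h
    simp at this
    try omega

/-- An orthonormal frame of the tangent space at `p`, built from an orthonormal basis `f` of the
ambient space that begins with `e, p.fst, p.snd`. -/
def tangentFrame (p : CD F) (f : Fin (3 + 5) → F) : Unit ⊕ (Fin 5 ⊕ Fin 5) → CD F
  | .inl _ => (√2)⁻¹ • rot p
  | .inr (.inl k) => mk (f (Fin.natAdd 3 k)) 0
  | .inr (.inr k) => mk 0 (f (Fin.natAdd 3 k))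

theorem trace_eq [FiniteDimensional ℝ F] (hp : p ∈ orthoPairs e)
    (f : OrthonormalBasis (Fin (3 + 5)) ℝ F) (h0 : f 0 = e) (h1 : f 1 = p.fst) (h2 : f 2 = p.snd)
    (A : tangentSpaceOf (orthoPairs e) p →ₗ[ℝ] tangentSpaceOf (orthoPairs e) p) (A' : CD F → CD F)
    (hA : ∀ z : tangentSpaceOf (orthoPairs e) p, (A z : CD F) = A' z) :
    LinearMap.trace ℝ _ A = inner ℝ (rot p) (A' (rot p)) / 2 +
      (∑ k : Fin 5, inner ℝ (mk (f (Fin.natAdd 3 k)) 0) (A' (mk (f (Fin.natAdd 3 k)) 0)) +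
      ∑ k : Fin 5, inner ℝ (mk 0 (f (Fin.natAdd 3 k))) (A' (mk 0 (f (Fin.natAdd 3 k))))) := by
  have hf : ∀ i j, inner ℝ (f i) (f j) = if i = j then 1 else 0 :=
    orthonormal_iff_ite.1 f.orthonormal
  have hw := inner_natAdd_adapted f h0 h1 h2
  have e1 := inner_fst_self hp
  have e2 := inner_snd_self hp
  have hmem : ∀ i, tangentFrame p f i ∈ tangentSpaceOf (orthoPairs e) p := by
    rintro (_ | k | k)
    · exact Submodule.smul_mem _ _ (rot_mem_tangentSpaceOf hp)
    · exact mk_zero_right_mem_tangentSpaceOf hp (hw k).1 (hw k).2.1 (hw k).2.2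
    · exact mk_zero_left_mem_tangentSpaceOf hp (hw k).1 (hw k).2.1 (hw k).2.2
  let v : Unit ⊕ (Fin 5 ⊕ Fin 5) → tangentSpaceOf (orthoPairs e) p :=
    fun i => ⟨tangentFrame p f i, hmem i⟩
  -- `rot p` has norm `√2`
  have h22 : (√2)⁻¹ * (√2)⁻¹ = (1 / 2 : ℝ) := by
    rw [← mul_inv, Real.mul_self_sqrt (by norm_num)]; norm_num
  have hv : Orthonormal ℝ v := by
    rw [orthonormal_iff_ite]
    intro i j
    rw [Submodule.coe_inner]
    change inner ℝ (tangentFrame p f i) (tangentFrame p f j) = _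
    rcases i with _ | k | k <;> rcases j with _ | l | l
    · simp only [tangentFrame, inner_smul_left, inner_smul_right, conj_trivial, inner_def,
        fst_rot, snd_rot, inner_neg_neg, e1, e2, if_pos]
      rw [← mul_assoc, h22]; norm_num
    · simp [tangentFrame, inner_smul_left, inner_def, (hw l).2.2]
    · simp [tangentFrame, inner_smul_left, inner_def, (hw l).2.1]
    · rw [real_inner_comm]
      simp [tangentFrame, inner_smul_left, inner_def, (hw k).2.2]
    · simp [tangentFrame, inner_def, hf, (Fin.natAdd_injective 5 3).eq_iff, -inner_self_eq_norm_sq_to_K]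
    · simp [tangentFrame, inner_def]
    · rw [real_inner_comm]
      simp [tangentFrame, inner_smul_left, inner_def, (hw k).2.1]
    · simp [tangentFrame, inner_def]
    · simp [tangentFrame, inner_def, hf, (Fin.natAdd_injective 5 3).eq_iff, -inner_self_eq_norm_sq_to_K]
  have hsp : (Submodule.span ℝ (Set.range v))ᗮ = ⊥ := by
    rw [Submodule.eq_bot_iff]
    intro z hz
    have hz' : ∀ i, inner ℝ (tangentFrame p f i) (z : CD F) = 0 := fun i =>
      (Submodule.mem_orthogonal _ _).1 hz (v i) (Submodule.subset_span ⟨i, rfl⟩)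
    obtain ⟨z1, z2, z3, z4, z5⟩ := (mem_tangentSpaceOf_iff hp).1 z.2
    have hr := hz' (.inl ())
    simp only [tangentFrame, inner_smul_left, conj_trivial, inner_def, fst_rot, snd_rot,
      inner_neg_left] at hr
    have hr' := (mul_eq_zero.1 hr).resolve_left (by positivity)
    have hall : ∀ u : F, (∀ i, inner ℝ (f i) u = 0) → u = 0 := fun u hu =>
      InnerProductSpace.ext_inner_left_basis f.toBasis (by simpa using hu)
    have hsplit : ∀ u : F, inner ℝ e u = 0 → inner ℝ p.fst u = 0 → inner ℝ p.snd u = 0 →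
        (∀ k : Fin 5, inner ℝ (f (Fin.natAdd 3 k)) u = 0) → u = 0 := by
      intro u u0 u1 u2 hk
      refine hall u fun i => ?_
      refine Fin.addCases (fun i => ?_) hk i
      fin_cases i
      · exact h0 ▸ u0
      · exact h1 ▸ u1
      · exact h2 ▸ u2
    apply Subtype.ext
    apply CD.ext
    · refine hsplit _ z1 z3 (by linarith) fun k => ?_
      simpa [tangentFrame, inner_def] using hz' (.inr (.inl k))
    · refine hsplit _ z2 (by linarith) z4 fun k => ?_
      simpa [tangentFrame, inner_def] using hz' (.inr (.inr k))
  rw [LinearMap.trace_eq_sum_inner A (OrthonormalBasis.mkOfOrthogonalEqBot hv hsp)]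
  have hterm : ∀ i, inner ℝ (OrthonormalBasis.mkOfOrthogonalEqBot hv hsp i)
      (A (OrthonormalBasis.mkOfOrthogonalEqBot hv hsp i)) =
      inner ℝ (tangentFrame p f i) (A' (tangentFrame p f i)) := by
    intro i
    rw [OrthonormalBasis.coe_of_orthogonal_eq_bot_mk, Submodule.coe_inner, hA]
  rw [Finset.sum_congr rfl fun i _ => hterm i, Fintype.sum_sum_type, Fintype.sum_sum_type]
  congr 1
  have hrot := hA ⟨rot p, rot_mem_tangentSpaceOf hp⟩
  have hA' : A' ((√2)⁻¹ • rot p) = (√2)⁻¹ • A' (rot p) := by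
    have h := hA ((√2)⁻¹ • ⟨rot p, rot_mem_tangentSpaceOf hp⟩)
    rw [map_smul, Submodule.coe_smul, hrot] at h
    exact h.symm
  simp only [tangentFrame, Finset.univ_unique, Finset.sum_singleton, hA', inner_smul_left,
    inner_smul_right, conj_trivial]
  rw [← mul_assoc, h22]; ring

/-- The dimension is the trace of the identity. -/
theorem finrank_tangentSpaceOf [FiniteDimensional ℝ F] (hF : Module.finrank ℝ F = 8)
    (he : ‖e‖ = 1) (hp : p ∈ orthoPairs e) :
    Module.finrank ℝ (tangentSpaceOf (orthoPairs e) p) = 11 := by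
  obtain ⟨f, f0, f1, f2⟩ := exists_adapted_basis hF he hp
  have h := trace_eq hp f f0 f1 f2 LinearMap.id (fun x => x) (fun _ => rfl)
  have hww : ∀ k : Fin 5, inner ℝ (f (Fin.natAdd 3 k)) (f (Fin.natAdd 3 k)) = 1 := fun k => by
    rw [orthonormal_iff_ite.1 f.orthonormal, if_pos rfl]
  rw [LinearMap.trace_id, inner_rot_self hp] at h
  simp only [inner_def, fst_mk, snd_mk, inner_zero_left, zero_add, add_zero, hww,
    Finset.sum_const, Finset.card_univ, Fintype.card_fin, nsmul_eq_mul] at h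
  norm_num at h
  exact_mod_cast h

/-! ### Ricci and scalar curvature -/

/-- `g` is a Riemannian metric whose restriction to `orthoPairs e` is `squashedMetric c`. -/
structure IsSquashed (e : F) (c : ℝ) (g : CD F → CD F →L[ℝ] CD F →L[ℝ] ℝ) : Prop where
  isRiemannianMetric : IsRiemannianMetric (orthoPairs e) g
  eq : ∀ p ∈ orthoPairs e, ∀ x ∈ tangentSpaceOf (orthoPairs e) p,
    ∀ y ∈ tangentSpaceOf (orthoPairs e) p, g p x y = squashedMetric c p x y

theorem curvatureForm_add_left (c : ℝ) (p z z' x y : CD F) :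
    curvatureForm c p (z + z') x y = curvatureForm c p z x y + curvatureForm c p z' x y := by
  have h : normalForm x y (z + z') = normalForm x y z + normalForm x y z' := by
    ext <;> simp only [normalForm, fst_mk, snd_mk, fst_add, snd_add] <;> module
  simp only [curvatureForm, christoffelDeriv, christoffel_add_left, christoffel_add_right, h,
    normalForm_add_left, map_add, inner_add_left, inner_add_right]
  module

theorem curvatureForm_smul_left (c : ℝ) (p : CD F) (r : ℝ) (z x y : CD F) :
    curvatureForm c p (r • z) x y = r • curvatureForm c p z x y := by
  have h : normalForm x y (r • z) = r • normalForm x y z := by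
    ext <;> simp only [normalForm, fst_mk, snd_mk, fst_smul, snd_smul] <;> module
  simp only [curvatureForm, christoffelDeriv, christoffel_smul_left, christoffel_smul_right, h,
    normalForm_smul_left, map_smul, inner_smul_left, inner_smul_right, conj_trivial]
  module

variable {g : CD F → CD F →L[ℝ] CD F →L[ℝ] ℝ}

theorem curvatureForm_mem (he : ‖e‖ = 1) (hg : IsSquashed e c g)
    (hp : p ∈ orthoPairs e) {x y z : CD F} (hx : x ∈ tangentSpaceOf (orthoPairs e) p)
    (hy : y ∈ tangentSpaceOf (orthoPairs e) p) (hz : z ∈ tangentSpaceOf (orthoPairs e) p) :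
    curvatureForm c p z x y ∈ tangentSpaceOf (orthoPairs e) p := by
  have hD : IsLeviCivita (orthoPairs e) g (connection c) :=
    (isLeviCivita_connection c).congr (contDiff_squashedMetric c) hg.1.smooth
      fun p hp x hx y hy => (hg.2 p hp x hx y hy).symm
  obtain ⟨X, hX, rfl⟩ := exists_isVectorField he p hp x hx
  obtain ⟨Y, hY, rfl⟩ := exists_isVectorField he p hp y hy
  obtain ⟨Z, hZ, rfl⟩ := exists_isVectorField he p hp z hz
  have hB := hD.isVectorField_lieBracket hZ hX
  rw [← curvature_eq he hg.1 hg.2 hZ hX hY hp]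
  have h := fun {X Y} => hD.isVectorField_leviCivita (X := X) (Y := Y)
  exact Submodule.sub_mem _ (Submodule.sub_mem _ ((h hZ (h hX hY)).2 p hp)
    ((h hX (h hZ hY)).2 p hp)) ((h hB hY).2 p hp)

theorem coe_curvatureEndo (he : ‖e‖ = 1) (hg : IsSquashed e c g)
    (hp : p ∈ orthoPairs e) {x y : CD F} (hx : x ∈ tangentSpaceOf (orthoPairs e) p)
    (hy : y ∈ tangentSpaceOf (orthoPairs e) p) (z : tangentSpaceOf (orthoPairs e) p) :
    (curvatureEndo (orthoPairs e) g p x y z : CD F) = curvatureForm c p z x y := by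
  have hex : ∃ A, IsCurvatureEndo (orthoPairs e) g p x y A := by
    refine ⟨{ toFun := fun z => ⟨curvatureForm c p z x y, curvatureForm_mem he hg hp hx hy z.2⟩
              map_add' := fun z z' => Subtype.ext (curvatureForm_add_left c p z z' x y)
              map_smul' := fun r z => Subtype.ext (curvatureForm_smul_left c p r z x y) }, ?_⟩
    intro X Y Z hX hY hZ hXp hYp z hzZ
    rw [curvature_eq he hg.1 hg.2 hZ hX hY hp, ← hzZ, hXp, hYp]
    rfl
  obtain ⟨X, hX, hXp⟩ := exists_isVectorField he p hp x hx
  obtain ⟨Y, hY, hYp⟩ := exists_isVectorField he p hp y hy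
  obtain ⟨Z, hZ, hZp⟩ := exists_isVectorField he p hp z z.2
  have h1 : curvatureEndo (orthoPairs e) g p x y = hex.choose := dif_pos hex
  rw [h1, hex.choose_spec X Y Z hX hY hZ hXp hYp z hZp.symm,
    curvature_eq he hg.1 hg.2 hZ hX hY hp, hXp, hYp, hZp]

/-- Parseval's identity for the last five vectors of an adapted basis. -/
theorem sum_inner_mul_inner_adapted (f : OrthonormalBasis (Fin (3 + 5)) ℝ F) (h0 : f 0 = e)
    (h1 : f 1 = p.fst) (h2 : f 2 = p.snd) {u v : F} (hu : inner ℝ e u = 0) :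
    ∑ k : Fin 5, inner ℝ u (f (Fin.natAdd 3 k)) * inner ℝ (f (Fin.natAdd 3 k)) v =
      inner ℝ u v - inner ℝ p.fst u * inner ℝ p.fst v - inner ℝ p.snd u * inner ℝ p.snd v := by
  have h := f.sum_inner_mul_inner u v
  rw [Fin.sum_univ_add, Fin.sum_univ_three] at h
  change inner ℝ u (f 0) * inner ℝ (f 0) v + inner ℝ u (f 1) * inner ℝ (f 1) v +
    inner ℝ u (f 2) * inner ℝ (f 2) v + _ = _ at h
  rw [h0, h1, h2, real_inner_comm e u, hu, real_inner_comm p.fst u, real_inner_comm p.snd u] at h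
  linarith

variable [FiniteDimensional ℝ F]

theorem ricci_eq (hF : Module.finrank ℝ F = 8) (he : ‖e‖ = 1) (hg : IsSquashed e c g)
    (hp : p ∈ orthoPairs e) {x y : CD F} (hx : x ∈ tangentSpaceOf (orthoPairs e) p)
    (hy : y ∈ tangentSpaceOf (orthoPairs e) p) :
    ricci (orthoPairs e) g p x y = (4 - 2 * c) * squashedMetric c p x y +
      (12 * c ^ 2 + 7 * c + 1 / 2) * (inner ℝ (rot p) x * inner ℝ (rot p) y) := by
  obtain ⟨f, h0, h1, h2⟩ := exists_adapted_basis hF he hp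
  have hf : ∀ i j, inner ℝ (f i) (f j) = if i = j then 1 else 0 :=
    orthonormal_iff_ite.1 f.orthonormal
  have hx' := (mem_tangentSpaceOf_iff hp).1 hx
  have hy' := (mem_tangentSpaceOf_iff hp).1 hy
  have hw := inner_natAdd_adapted f h0 h1 h2
  rw [ricci, trace_eq hp f h0 h1 h2 _ (fun z => curvatureForm c p z x y)
    (coe_curvatureEndo he hg hp hx hy), inner_curvatureForm_rot hp hx' hy']
  have hr : ∀ k : Fin 5, _ := fun k => inner_curvatureForm_mk_zero_right (c := c) hp hx' hy'
    (hw k).1 (hw k).2.1 (hw k).2.2 (by rw [hf, if_pos rfl])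
  have hl : ∀ k : Fin 5, _ := fun k => inner_curvatureForm_mk_zero_left (c := c) hp hx' hy'
    (hw k).1 (hw k).2.1 (hw k).2.2 (by rw [hf, if_pos rfl])
  simp only [hr, hl, Finset.sum_sub_distrib, ← Finset.mul_sum, Finset.sum_const, Finset.card_univ,
    Fintype.card_fin, nsmul_eq_mul]
  obtain ⟨x1, x2, x3, x4, x5⟩ := hx'
  obtain ⟨y1, y2, y3, y4, y5⟩ := hy'
  rw [sum_inner_mul_inner_adapted f h0 h1 h2 x1, sum_inner_mul_inner_adapted f h0 h1 h2 x2,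
    squashedMetric_apply]
  have x5' : inner ℝ p.snd x.fst = -inner ℝ p.fst x.snd := by linarith
  have y5' : inner ℝ p.snd y.fst = -inner ℝ p.fst y.snd := by linarith
  simp only [inner_def, fst_rot, snd_rot, inner_neg_left, x3, x4, y3, y4, x5', y5']
  push_cast
  ring

/-- The Ricci endomorphism is `(4 - 2c) id + (6c + 1/2) η ⊗ rot p`; the tangent space has
dimension `11` and `η(rot p) = 2`. -/
theorem scalarCurvature_eq (hF : Module.finrank ℝ F = 8) (he : ‖e‖ = 1) (hg : IsSquashed e c g)
    (hp : p ∈ orthoPairs e) :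
    scalarCurvature (orthoPairs e) g p = 45 - 10 * c := by
  set T := tangentSpaceOf (orthoPairs e) p with hT
  have hrot : rot p ∈ T := rot_mem_tangentSpaceOf hp
  have hrr := inner_rot_self hp
  have hric : ∀ x y : T, ricci (orthoPairs e) g p x y =
      g p ((4 - 2 * c) • (x : CD F) + ((6 * c + 1 / 2) * inner ℝ (rot p) (x : CD F)) • rot p) y := by
    intro x y
    rw [ricci_eq hF he hg hp x.2 y.2, hg.eq p hp _ (T.add_mem (T.smul_mem _ x.2)
      (T.smul_mem _ hrot)) _ y.2, squashedMetric_apply, squashedMetric_apply]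
    simp only [inner_add_left, inner_smul_left, inner_add_right, inner_smul_right, hrr,
      conj_trivial]
    ring
  have hex : ∃ S, IsRicciEndo (orthoPairs e) g p S := by
    refine ⟨(4 - 2 * c) • LinearMap.id + (6 * c + 1 / 2) •
      LinearMap.smulRight ((innerₗ (CD F) (rot p)).comp T.subtype) ⟨rot p, hrot⟩, fun x y => ?_⟩
    rw [hric]
    simp [smul_smul]
  have h1 : scalarCurvature (orthoPairs e) g p = LinearMap.trace ℝ _ hex.choose := dif_pos hex
  have hS : ∀ x : T, (hex.choose x : CD F) =
      (4 - 2 * c) • (x : CD F) + ((6 * c + 1 / 2) * inner ℝ (rot p) (x : CD F)) • rot p := by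
    intro x
    -- a tangent vector is determined by its inner products, since the metric is definite
    have hm := T.add_mem (T.smul_mem (4 - 2 * c) x.2)
      (T.smul_mem ((6 * c + 1 / 2) * inner ℝ (rot p) (x : CD F)) hrot)
    by_contra hne
    have hd := T.sub_mem (hex.choose x).2 hm
    have h2 := hg.isRiemannianMetric.pos p hp _ hd (sub_ne_zero.2 hne)
    have h3 := hex.choose_spec x ⟨_, hd⟩
    rw [hric] at h3
    rw [map_sub (g p), sub_apply, h3, sub_self] at h2
    exact lt_irrefl _ h2
  obtain ⟨f, f0, f1, f2⟩ := exists_adapted_basis hF he hp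
  have hf : ∀ i j, inner ℝ (f i) (f j) = if i = j then 1 else 0 :=
    orthonormal_iff_ite.1 f.orthonormal
  have hw := inner_natAdd_adapted f f0 f1 f2
  have hr : ∀ k : Fin 5, inner ℝ (rot p) (mk (f (Fin.natAdd 3 k)) 0) = 0 := fun k => by
    simp [inner_def, (hw k).2.2]
  have hl : ∀ k : Fin 5, inner ℝ (rot p) (mk 0 (f (Fin.natAdd 3 k))) = 0 := fun k => by
    simp [inner_def, (hw k).2.1]
  have hww : ∀ k : Fin 5, inner ℝ (f (Fin.natAdd 3 k)) (f (Fin.natAdd 3 k)) = 1 := fun k => by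
    rw [hf, if_pos rfl]
  rw [h1, trace_eq hp f f0 f1 f2 _ (fun x =>
    (4 - 2 * c) • x + ((6 * c + 1 / 2) * inner ℝ (rot p) x) • rot p) hS]
  simp only [inner_add_right, inner_smul_right, hrr, hr, hl, mul_zero, zero_mul, add_zero,
    inner_def (mk _ _) (mk _ _), fst_mk, snd_mk, inner_zero_left, zero_add, hww, Finset.sum_const,
    Finset.card_univ, Fintype.card_fin, nsmul_eq_mul]
  push_cast
  ring

/-- Comparing the direction `rot p` with a direction orthogonal to it, the term `η ⊗ η` of the
Ricci tensor has to vanish; its coefficient is `(12c + 1)(2c + 1) / 2`. -/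
theorem isEinstein_iff (hF : Module.finrank ℝ F = 8) (he : ‖e‖ = 1) (hg : IsSquashed e c g)
    (hc : 1 + 2 * c ≠ 0) (hne : (orthoPairs e).Nonempty) :
    IsEinstein (orthoPairs e) g ↔ 12 * c + 1 = 0 := by
  constructor
  · rintro ⟨l, hl⟩
    obtain ⟨p, hp⟩ := hne
    have hrot : rot p ∈ tangentSpaceOf (orthoPairs e) p := rot_mem_tangentSpaceOf hp
    have hrr := inner_rot_self hp
    obtain ⟨f, f0, f1, f2⟩ := exists_adapted_basis hF he hp
    obtain ⟨w0, w1, w2⟩ := inner_natAdd_adapted f f0 f1 f2 0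
    have hww : inner ℝ (f (Fin.natAdd 3 0)) (f (Fin.natAdd 3 0)) = 1 := by
      rw [orthonormal_iff_ite.1 f.orthonormal, if_pos rfl]
    have hwT := mk_zero_right_mem_tangentSpaceOf hp w0 w1 w2
    have a1 := hl p hp _ hrot _ hrot
    have a2 := hl p hp _ hwT _ hwT
    rw [hg.eq p hp _ hrot _ hrot, ricci_eq hF he hg hp hrot hrot, squashedMetric_apply, hrr] at a1
    rw [hg.eq p hp _ hwT _ hwT, ricci_eq hF he hg hp hwT hwT, squashedMetric_apply] at a2
    simp only [inner_def, fst_mk, snd_mk, fst_rot, snd_rot, inner_neg_left, w2, hww,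
      inner_zero_right] at a2
    have a3 : l = 4 - 2 * c := by linarith
    rw [a3] at a1
    have a4 : (12 * c + 1) * (1 + 2 * c) = 0 := by linear_combination a1 / 2
    exact (mul_eq_zero.1 a4).resolve_right hc
  · intro h
    refine ⟨4 - 2 * c, fun p hp x hx y hy => ?_⟩
    rw [ricci_eq hF he hg hp hx hy, hg.eq p hp x hx y hy]
    linear_combination (c + 1 / 2) * (inner ℝ (rot p) x * inner ℝ (rot p) y) * h

end CD

/-! ### The invariant metrics on the Stiefel manifold -/

theorem stiefel_eq_orthoPairs : stiefel = CD.orthoPairs (1 : Oct) := by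
  ext u
  simp only [stiefel, CD.orthoPairs, Set.mem_ofPred_eq, Oct.isImag_iff]

theorem Oct.norm_one : ‖(1 : Oct)‖ = 1 := by
  rw [norm_eq_sqrt_real_inner, inner_one_one, Real.sqrt_one]

theorem skewE_octBasis (i j k : Fin 8) : skewE i j (octBasis k) =
    (if i = k then (1 : ℝ) else 0) • octBasis j - (if j = k then (1 : ℝ) else 0) • octBasis i := by
  simp only [skewE, LinearMap.sub_apply, LinearMap.smulRight_apply, innerₗ_apply_apply,
    inner_octBasis]

/-- For each `i`, the image of `e₁` under `X_i` is the multiple `fstCoeff i` of the basis vector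
with index `fstIndex i`; where the coefficient is `0`, the index is an arbitrary `0`. -/
def fstCoeff : Fin 14 → ℝ :=
  ![0, 0, 0, 0, √3 / 3, -(√3 / 3), -(1 / 2), 1 / 2, -(1 / 2), 1 / 2, √3 / 6, √3 / 6, -(√3 / 6),
    -(√3 / 6)]

/-- See `fstCoeff`. -/
def fstIndex : Fin 14 → Fin 8 := ![0, 0, 0, 0, 3, 2, 7, 6, 5, 4, 6, 7, 4, 5]

/-- For each `i`, the image of `e₂` under `X_i` is the multiple `sndCoeff i` of the basis vector
with index `sndIndex i`. -/
def sndCoeff : Fin 14 → ℝ :=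
  ![0, 0, 0, -(√3 / 3), 0, √3 / 3, 1 / 2, 1 / 2, 1 / 2, 1 / 2, -(√3 / 6), √3 / 6, √3 / 6,
    -(√3 / 6)]

/-- See `sndCoeff`. -/
def sndIndex : Fin 14 → Fin 8 := ![0, 0, 0, 3, 0, 1, 4, 5, 6, 7, 5, 4, 7, 6]

theorem fst_baseVec (i : Fin 14) : (baseVec i).fst = fstCoeff i • octBasis (fstIndex i) := by
  change g2Basis i (octBasis 1) = _
  fin_cases i <;>
  simp [g2Basis, fstCoeff, fstIndex, skewE_octBasis, smul_smul, -one_div] <;> module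

theorem snd_baseVec (i : Fin 14) : (baseVec i).snd = sndCoeff i • octBasis (sndIndex i) := by
  change g2Basis i (octBasis 2) = _
  fin_cases i <;>
  simp [g2Basis, sndCoeff, sndIndex, skewE_octBasis, smul_smul, -one_div] <;> module

/-- The Euclidean Gram matrix of the `X_i` at the base point: it is the one of `g_r` for `r = 2/3`. -/
theorem inner_baseVec (i j : Fin 14) :
    inner ℝ (baseVec i) (baseVec j) = if i = j then grCoeff (2 / 3) i else 0 := by
  have h3 : √3 * √3 = 3 := Real.mul_self_sqrt (by norm_num)
  rw [CD.inner_def, fst_baseVec, fst_baseVec, snd_baseVec, snd_baseVec, inner_smul_left,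
    inner_smul_left, inner_smul_right, inner_smul_right, inner_octBasis, inner_octBasis,
    conj_trivial, conj_trivial]
  fin_cases i <;> fin_cases j <;>
  simp [fstCoeff, fstIndex, sndCoeff, sndIndex, grCoeff] <;> nlinarith

theorem inner_rot_baseVec (i : Fin 14) :
    inner ℝ (CD.rot stiefelBase) (baseVec i) = if i = 5 then 2 * √3 / 3 else 0 := by
  rw [CD.inner_def, fst_baseVec, snd_baseVec, inner_smul_right, inner_smul_right]
  change _ * inner ℝ (-octBasis 2) _ + _ * inner ℝ (octBasis 1) _ = _
  rw [inner_neg_left, inner_octBasis, inner_octBasis]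
  fin_cases i <;> simp [fstCoeff, fstIndex, sndCoeff, sndIndex] <;> ring

theorem stiefelBase_mem_orthoPairs : stiefelBase ∈ CD.orthoPairs (1 : Oct) :=
  stiefel_eq_orthoPairs ▸ stiefelBase_mem

theorem isTangent_baseVec (i : Fin 14) : CD.IsTangent (1 : Oct) stiefelBase (baseVec i) := by
  rw [CD.IsTangent, fst_baseVec, snd_baseVec]
  change _ ∧ _ ∧ inner ℝ (octBasis 1) _ = 0 ∧ inner ℝ (octBasis 2) _ = 0 ∧
    inner ℝ (octBasis 1) _ + inner ℝ (octBasis 2) _ = 0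
  simp only [Oct.one_def, inner_smul_right, inner_octBasis]
  fin_cases i <;> simp [fstCoeff, fstIndex, sndCoeff, sndIndex]

theorem grCoeff_pos {r : ℝ} (hr : 0 < r) {i : Fin 14} (hi : 3 ≤ i) : 0 < grCoeff r i := by
  fin_cases i <;> first | exact absurd hi (by decide) | simp [grCoeff, hr]

theorem linearIndependent_baseVec :
    LinearIndependent ℝ (fun i : {i : Fin 14 // 3 ≤ i} => baseVec i) := by
  refine linearIndependent_of_ne_zero_of_inner_eq_zero (fun i h => ?_) (fun i j hij => ?_)
  · have h1 := inner_baseVec i i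
    rw [h, inner_zero_left, if_pos rfl] at h1
    exact (grCoeff_pos (by norm_num) i.2).ne h1
  · exact (inner_baseVec i j).trans (if_neg fun h => hij (Subtype.ext h))

theorem tangentSpaceOf_stiefelBase :
    tangentSpaceOf stiefel stiefelBase = Submodule.span ℝ (baseVec '' {i | 3 ≤ i}) := by
  rw [stiefel_eq_orthoPairs]
  symm
  apply Submodule.eq_of_le_of_finrank_eq
  · rw [Submodule.span_le]
    rintro _ ⟨i, -, rfl⟩
    exact (CD.mem_tangentSpaceOf_iff stiefelBase_mem_orthoPairs).2 (isTangent_baseVec i)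
  · rw [CD.finrank_tangentSpaceOf finrank_oct Oct.norm_one stiefelBase_mem_orthoPairs]
    have h := finrank_span_eq_card linearIndependent_baseVec
    rw [Set.image_eq_range]
    exact h.trans (by decide)

theorem isTangent_g2Act (h : G2) {p v : Sed} (hv : CD.IsTangent (1 : Oct) p v) :
    CD.IsTangent (1 : Oct) (g2Act h p) (g2Act h v) := by
  rw [CD.IsTangent, fst_g2Act, fst_g2Act, snd_g2Act, snd_g2Act, G2.inner_one_map, G2.inner_one_map,
    G2.inner_map, G2.inner_map, G2.inner_map, G2.inner_map]
  exact hv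

theorem g2Act_inv_left (h : G2) (x : Sed) : g2Act h⁻¹ (g2Act h x) = x :=
  CD.ext ((h : Oct ≃ₗ[ℝ] Oct).symm_apply_apply _) ((h : Oct ≃ₗ[ℝ] Oct).symm_apply_apply _)

theorem g2Act_inv_right (h : G2) (x : Sed) : g2Act h (g2Act h⁻¹ x) = x :=
  CD.ext ((h : Oct ≃ₗ[ℝ] Oct).apply_symm_apply _) ((h : Oct ≃ₗ[ℝ] Oct).apply_symm_apply _)

theorem g2Act_mem_stiefel (h : G2) {p : Sed} (hp : p ∈ stiefel) : g2Act h p ∈ stiefel := by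
  rw [stiefel_eq_orbit] at hp ⊢
  obtain ⟨k, rfl⟩ := hp
  exact ⟨h * k, rfl⟩

theorem g2Act_mem_tangentSpaceOf (h : G2) {p v : Sed} (hp : p ∈ stiefel)
    (hv : v ∈ tangentSpaceOf stiefel p) : g2Act h v ∈ tangentSpaceOf stiefel (g2Act h p) := by
  have hp' := g2Act_mem_stiefel h hp
  rw [stiefel_eq_orthoPairs] at *
  rw [CD.mem_tangentSpaceOf_iff hp] at hv
  rw [CD.mem_tangentSpaceOf_iff hp']
  exact isTangent_g2Act h hv

theorem rot_g2Act (h : G2) (p : Sed) : CD.rot (g2Act h p) = g2Act h (CD.rot p) :=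
  CD.ext (map_neg (h : Oct ≃ₗ[ℝ] Oct) p.snd).symm rfl

theorem squashedMetric_g2Act (c : ℝ) (h : G2) (p x y : Sed) :
    CD.squashedMetric c (g2Act h p) (g2Act h x) (g2Act h y) = CD.squashedMetric c p x y := by
  rw [CD.squashedMetric_apply, CD.squashedMetric_apply, rot_g2Act, inner_g2Act, inner_g2Act,
    inner_g2Act]

theorem squashedMetric_baseVec (r : ℝ) (i j : Fin 14) :
    CD.squashedMetric (3 * r / 4 - 1 / 2) stiefelBase (baseVec i) (baseVec j) =
      if i = j then grCoeff r i else 0 := by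
  have h3 : √3 * √3 = 3 := Real.mul_self_sqrt (by norm_num)
  have hr : grCoeff r i = grCoeff (2 / 3) i + if i = 5 then r - 2 / 3 else 0 := by
    fin_cases i <;> simp [grCoeff]
  rw [CD.squashedMetric_apply, inner_baseVec, inner_rot_baseVec, inner_rot_baseVec, hr]
  by_cases hij : i = j
  · subst hij
    by_cases hi : i = 5
    · simp only [hi, if_true]; linear_combination (3 * r / 4 - 1 / 2) * (4 / 9) * h3
    · simp [hi]
  · by_cases hi : i = 5
    · have hj : j ≠ 5 := fun h => hij (hi.trans h.symm)
      simp [hij, hj]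
    · simp [hij, hi]

/-- An invariant metric is determined by its coefficients at the base point, and `squashedMetric` is
invariant with the coefficients of `g_r` when `c = 3 r / 4 - 1 / 2`. -/
theorem IsMetricGr.isSquashed {r : ℝ} {g : Sed → Sed →L[ℝ] Sed →L[ℝ] ℝ} (hg : IsMetricGr r g) :
    CD.IsSquashed (1 : Oct) (3 * r / 4 - 1 / 2) g := by
  refine ⟨stiefel_eq_orthoPairs ▸ hg.isRiemannianMetric, ?_⟩
  rw [← stiefel_eq_orthoPairs]
  have hbase : ∀ x ∈ tangentSpaceOf stiefel stiefelBase, ∀ y ∈ tangentSpaceOf stiefel stiefelBase,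
      g stiefelBase x y = CD.squashedMetric (3 * r / 4 - 1 / 2) stiefelBase x y := by
    rw [tangentSpaceOf_stiefelBase]
    intro x hx y hy
    induction hx, hy using Submodule.span_induction₂ with
    | mem_mem x y hx hy =>
      obtain ⟨i, hi, rfl⟩ := hx
      obtain ⟨j, hj, rfl⟩ := hy
      rw [hg.base i j hi hj, squashedMetric_baseVec]
    | zero_left y hy => simp
    | zero_right x hx => simp
    | add_left x y z _ _ _ h1 h2 => simp only [map_add, add_apply, h1, h2]
    | add_right x y z _ _ _ h1 h2 => simp only [map_add, h1, h2]
    | smul_left a x y _ _ h => simp only [map_smul, smul_apply, h]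
    | smul_right a x y _ _ h => simp only [map_smul, h]
  intro p hp x hx y hy
  have hp' := hp
  rw [stiefel_eq_orbit] at hp'
  obtain ⟨h, rfl⟩ := hp'
  have hx' := g2Act_mem_tangentSpaceOf h⁻¹ hp hx
  have hy' := g2Act_mem_tangentSpaceOf h⁻¹ hp hy
  rw [g2Act_inv_left] at hx' hy'
  rw [← g2Act_inv_right h x, ← g2Act_inv_right h y, squashedMetric_g2Act,
    hg.invariant h _ stiefelBase_mem _ hx' _ hy', hbase _ hx' _ hy']

theorem isMetricGr_squashedMetric {r : ℝ} (hr : 0 < r) :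
    IsMetricGr r (CD.squashedMetric (F := Oct) (3 * r / 4 - 1 / 2)) where
  isRiemannianMetric := stiefel_eq_orthoPairs ▸
    CD.isRiemannianMetric_squashedMetric (by linarith)
  invariant h p _ x _ y _ := squashedMetric_g2Act _ h p x y
  base i j _ _ := squashedMetric_baseVec r i j

theorem unitVec_mem (r : ℝ) {i : Fin 14} (hi : 3 ≤ i) :
    unitVec r i ∈ tangentSpaceOf stiefel stiefelBase := by
  rw [tangentSpaceOf_stiefelBase]
  exact Submodule.smul_mem _ _ (Submodule.subset_span ⟨i, hi, rfl⟩)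

theorem squashedMetric_unitVec {r : ℝ} (hr : 0 < r) {i j : Fin 14} (hi : 3 ≤ i) :
    CD.squashedMetric (3 * r / 4 - 1 / 2) stiefelBase (unitVec r i) (unitVec r j) =
      if i = j then 1 else 0 := by
  rw [unitVec, unitVec, map_smul, map_smul, smul_apply, squashedMetric_baseVec, smul_eq_mul,
    smul_eq_mul]
  by_cases hij : i = j
  · subst hij
    have h := grCoeff_pos hr hi
    rw [if_pos rfl, if_pos rfl, ← mul_assoc, ← mul_inv, Real.mul_self_sqrt h.le,
      inv_mul_cancel₀ h.ne']
  · rw [if_neg hij, if_neg hij, mul_zero, mul_zero]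

theorem squashedMetric_sum_unitVec {r : ℝ} (hr : 0 < r) (s t : Fin 14 → ℝ) :
    CD.squashedMetric (3 * r / 4 - 1 / 2) stiefelBase (∑ i ∈ Finset.Ici 3, s i • unitVec r i)
      (∑ i ∈ Finset.Ici 3, t i • unitVec r i) = ∑ i ∈ Finset.Ici 3, s i * t i := by
  rw [map_sum (CD.squashedMetric (3 * r / 4 - 1 / 2) stiefelBase), sum_apply]
  refine Finset.sum_congr rfl fun i hi => ?_
  rw [map_sum, Finset.sum_eq_single_of_mem i hi]
  · rw [map_smul, map_smul, smul_apply, squashedMetric_unitVec hr (Finset.mem_Ici.1 hi),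
      if_pos rfl, smul_eq_mul, smul_eq_mul, mul_one, mul_comm]
  · intro j _ hj
    rw [map_smul, map_smul, smul_apply, squashedMetric_unitVec hr (Finset.mem_Ici.1 hi),
      if_neg hj.symm, smul_zero, smul_zero]

theorem inner_rot_sum_unitVec (r : ℝ) (s : Fin 14 → ℝ) :
    inner ℝ (CD.rot stiefelBase) (∑ i ∈ Finset.Ici 3, s i • unitVec r i) =
      s 5 * ((√r)⁻¹ * (2 * √3 / 3)) := by
  rw [inner_sum, Finset.sum_eq_single_of_mem (5 : Fin 14) (by decide)]
  · rw [unitVec, inner_smul_right, inner_smul_right, inner_rot_baseVec, if_pos rfl]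
    rfl
  · intro j _ hj
    rw [unitVec, inner_smul_right, inner_smul_right, inner_rot_baseVec, if_neg hj, mul_zero,
      mul_zero]

theorem mainTheorem4 :
    -- `V₂(ℝ⁷)` is `ZD(𝕊)`, it is homogeneous under `G₂`, and `𝔪` is its tangent space at the base point
    stiefel = sedZeroDivisors ∧
    stiefel = {p : Sed | ∃ h : G2, g2Act h stiefelBase = p} ∧
    LinearIndependent ℝ (fun i : {i : Fin 14 // 3 ≤ i} => baseVec i) ∧
    tangentSpaceOf stiefel stiefelBase = Submodule.span ℝ (baseVec '' {i | 3 ≤ i}) ∧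
    ∀ r : ℝ, 0 < r →
      -- the metric `g_r` exists and is unique
      (∃ g, IsMetricGr r g) ∧
      (∀ g g', IsMetricGr r g → IsMetricGr r g' → ∀ p ∈ stiefel,
        ∀ x ∈ tangentSpaceOf stiefel p, ∀ y ∈ tangentSpaceOf stiefel p, g p x y = g' p x y) ∧
      ∀ g, IsMetricGr r g →
        -- `g_{2/3}` is the metric induced by the Euclidean metric of `𝕊`
        (r = 2 / 3 → ∀ p ∈ stiefel, ∀ x ∈ tangentSpaceOf stiefel p,
          ∀ y ∈ tangentSpaceOf stiefel p, g p x y = inner ℝ x y) ∧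
        -- the Ricci tensor, at every point `h · (e₁, e₂)`
        (∀ (h : G2) (s t : Fin 14 → ℝ),
          ricci stiefel g (g2Act h stiefelBase)
              (g2Act h (∑ i ∈ Finset.Ici 3, s i • unitVec r i))
              (g2Act h (∑ i ∈ Finset.Ici 3, t i • unitVec r i)) =
            15 * r / 2 * (s 5 * t 5) +
              (5 - 3 * r / 2) * ∑ i ∈ (Finset.Ici 3).erase 5, s i * t i) ∧
        -- the Einstein condition
        (IsEinstein stiefel g ↔ r = 5 / 9) ∧
        -- the scalar curvature
        (∀ p ∈ stiefel, scalarCurvature stiefel g p = 50 - 15 * r / 2) ∧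
        ((∀ p ∈ stiefel, 0 < scalarCurvature stiefel g p) ↔ r < 20 / 3) := by
  refine ⟨stiefel_eq_sedZeroDivisors, stiefel_eq_orbit, linearIndependent_baseVec,
    tangentSpaceOf_stiefelBase, fun r hr => ⟨⟨_, isMetricGr_squashedMetric hr⟩,
    fun g g' hg hg' p hp x hx y hy => ?_, fun g hg => ?_⟩⟩
  · have h := hg.isSquashed.eq
    have h' := hg'.isSquashed.eq
    rw [← stiefel_eq_orthoPairs] at h h'
    rw [h p hp x hx y hy, h' p hp x hx y hy]
  have hs := hg.isSquashed
  have hscal : ∀ p ∈ stiefel, scalarCurvature stiefel g p = 50 - 15 * r / 2 := by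
    rw [stiefel_eq_orthoPairs]
    intro p hp
    rw [CD.scalarCurvature_eq finrank_oct Oct.norm_one hs hp]
    ring
  refine ⟨?_, fun h s t => ?_, ?_, hscal, ?_⟩
  · intro hr2 p hp x hx y hy
    rw [stiefel_eq_orthoPairs] at hp hx hy
    rw [hs.eq p hp x hx y hy, CD.squashedMetric_apply, hr2]
    ring
  · have hmem : ∀ s : Fin 14 → ℝ, ∑ i ∈ Finset.Ici 3, s i • unitVec r i ∈
        tangentSpaceOf stiefel stiefelBase := fun s =>
      Submodule.sum_mem _ fun i hi => Submodule.smul_mem _ _ (unitVec_mem r (Finset.mem_Ici.1 hi))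
    have hx := g2Act_mem_tangentSpaceOf h stiefelBase_mem (hmem s)
    have hy := g2Act_mem_tangentSpaceOf h stiefelBase_mem (hmem t)
    have hp := g2Act_mem_stiefel h stiefelBase_mem
    have h3 : √3 ^ 2 = 3 := Real.sq_sqrt (by norm_num)
    have hrr : (√r)⁻¹ ^ 2 * r = 1 := by
      rw [inv_pow, Real.sq_sqrt hr.le, inv_mul_cancel₀ hr.ne']
    rw [stiefel_eq_orthoPairs] at hp hx hy ⊢
    rw [CD.ricci_eq finrank_oct Oct.norm_one hs hp hx hy, squashedMetric_g2Act, rot_g2Act,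
      inner_g2Act, inner_g2Act, squashedMetric_sum_unitVec hr, inner_rot_sum_unitVec,
      inner_rot_sum_unitVec, ← Finset.add_sum_erase _ _ (by decide : (5 : Fin 14) ∈ Finset.Ici 3)]
    linear_combination (9 * r - 5) * (s 5 * t 5) * ((√r)⁻¹ ^ 2 * r / 3 * h3 + hrr)
  · rw [stiefel_eq_orthoPairs, CD.isEinstein_iff finrank_oct Oct.norm_one hs (by linarith)
      ⟨_, stiefelBase_mem_orthoPairs⟩]
    constructor <;> intro h <;> linarith
  · constructor
    · intro h
      have h1 := h _ stiefelBase_mem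
      rw [hscal _ stiefelBase_mem] at h1
      linarith
    · intro h p hp
      rw [hscal p hp]
      linarith

end
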